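/- For a real random variable $X$ let $\|X\|_{\psi_1}:=\inf\{t>0:\ \mathbb{E}\,e^{|X|/t}\le 2\}$. Let $K>0$. For $n\ge 1$ and $\nu>0$, let $W$ be an $n\times n$ complex random matrix with i.i.d. entries such that $$\mathbb{E}[W_{ij}]=0,\qquad \mathbb{E}|W_{ij}|^2=\nu,\qquad \sup_{\phi\in[0,2\pi)}\bigl\|\operatorname{Re}(e^{-i\phi}W_{ij})\bigr\|_{\psi_1}\le K\sqrt{\nu}.$$ Let $J$ be the $n\times n$ all-ones matrix, and put $$G_W(z):=\frac{1}{n!}\operatorname{per}(J+zW),\qquad X_W(z):=\exp\Bigl(-\frac{z}{n}\sum_{i,j=1}^n W_{ij}\Bigr)\,G_W(z).$$ (1) There are constants $c_*,C_*>0$ depending only on $K$ such that, for every $n\ge1$, every $\nu>0$, every such $W$ and every $R>0$ with $\nu R^2/n\le c_*$, the expectation $\mathbb{E}|X_W(z)|^2$ is finite for $|z|=R$, the function $\theta\mapsto\log\mathbb{E}|X_W(Re^{i\theta})|^2$ is integrable on $[0,2\pi]$ (where $\mathbb{E}$ is taken over $W$ only), and $$\frac{1}{2\pi}\int_0^{2\pi}\log\mathbb{E}\bigl|X_W(Re^{i\theta})\bigr|^2\,d\theta\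 \le\ \frac{C_*\,\nu^2R^4}{n}.$$ (2) For every $\varepsilon\in(0,1)$ there are $C>0$ and $n_0\in\mathbb{N}$, depending only on $K$ and $\varepsilon$, such that for every $\beta\in(0,1/4)$, every $n\ge n_0$, every $\nu>0$ and every such $W$, $$\mathbb{P}\Bigl[\exists z\in\mathbb{C}:\ |z|<(1-\varepsilon)\frac{n^{1/4-\beta}}{\sqrt{\nu}}\ \text{and}\ \operatorname{per}(J+zW)=0\Bigr]\ \le\ C\,n^{-4\beta}.$$ -/

import Mathlib

open MeasureTheory ProbabilityTheory

namespace PermanentUniversality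

/-- The sub-exponential (Orlicz) norm `‖X‖_{ψ₁} = inf {t > 0 : E exp(|X|/t) ≤ 2}` of a real random
variable, with value `∞` if there is no such `t`. -/
noncomputable def psi1Norm {Ω : Type*} [MeasurableSpace Ω] (P : Measure Ω) (X : Ω → ℝ) : ENNReal :=
  ⨅ (t : ℝ) (_ : 0 < t) (_ : ∫⁻ ω, ENNReal.ofReal (Real.exp (|X ω| / t)) ∂P ≤ 2), ENNReal.ofReal t

/-- `W` is an `n × n` complex random matrix with i.i.d. entries of mean zero and variance `ν` which
are sub-exponential in every direction: `sup_φ ‖Re (e^{-iφ} W_{ij})‖_{ψ₁} ≤ K √ν`. -/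
structure IsSubexponentialIIDMatrix {Ω : Type*} [MeasurableSpace Ω] (P : Measure Ω) {n : ℕ}
    (W : Ω → Matrix (Fin n) (Fin n) ℂ) (ν K : ℝ) : Prop where
  measurable : ∀ i j, Measurable fun ω => W ω i j
  indep : iIndepFun (fun (p : Fin n × Fin n) ω => W ω p.1 p.2) P
  identDistrib : ∀ i j k l, IdentDistrib (fun ω => W ω i j) (fun ω => W ω k l) P P
  integrable : ∀ i j, Integrable (fun ω => W ω i j) P
  mean_zero : ∀ i j, ∫ ω, W ω i j ∂P = 0
  integrable_sq : ∀ i j, Integrable (fun ω => ‖W ω i j‖ ^ 2) P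
  variance : ∀ i j, ∫ ω, ‖W ω i j‖ ^ 2 ∂P = ν
  subexponential : ∀ i j,
    ⨆ φ ∈ Set.Ico (0 : ℝ) (2 * Real.pi),
      psi1Norm P (fun ω => (Complex.exp (-(Complex.I * (φ : ℂ))) * W ω i j).re) ≤
        ENNReal.ofReal (K * √ν)

/-- `G_A(z) = per(J + zA) / n!`, where `J` is the all-ones matrix. -/
noncomputable def G {n : ℕ} (A : Matrix (Fin n) (Fin n) ℂ) (z : ℂ) : ℂ :=
  ((n.factorial : ℂ))⁻¹ * (Matrix.of (fun _ _ => (1 : ℂ)) + z • A).permanent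

/-- The first-order reweighting `X_A(z) = e^{-z S_A} G_A(z)`, with `S_A = (1/n) ∑_{i,j} A_{ij}`. -/
noncomputable def X {n : ℕ} (A : Matrix (Fin n) (Fin n) ℂ) (z : ℂ) : ℂ :=
  Complex.exp (-(z * ((n : ℂ)⁻¹ * ∑ i, ∑ j, A i j))) * G A z

end PermanentUniversality

/-! Multiplying by `e^{-zS}` moves no zeros of the permanent and removes the leading fluctuation.
Since `|e^{-zS}|²` is a product of weights `e^{-2 Re ζ/n}` with `ζ = z W_ij`, `|X_W(z)|²` is a
double sum over permutations of products over entries, and independence evaluates its mean exactly.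
Let `m`, `d`, `q` be the integrals of `1`, `ζ`, `|ζ|²` against this weight (not normalised by `m`).
Only the coincidences of the two permutations matter, so the mean is `m^{n²}` times the average over
`π` of a product with factor `1 + 2 Re d/m + q/m` at each fixed point and `α = |1 + d/m|²` elsewhere
(`integral_normSq_X`). Counting fixed points bounds it by `m^{n²} α^n e^{q/α}`
(`sum_perm_prod_fixed_le`).

By `log x ≤ x - 1`, the logarithm is at most `n²(m-1) + n(α-1) + q/α`. Up to small errors this is
`E[e^{-2 Re ζ/n} |n+ζ|²] - n²`, whose terms of order two and three are real parts of `-ζ²` and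
`2ζ³/(3n)` (`weight_mul_normSq_le`). After expectation these are multiples of `z²` and `z³`, with
zero average on every circle; the quartic remainder, of size `ν²R⁴/n`, is all that survives
(`circleAverage_log_le`).

For the zeros, let `F(z) = E|X_W(z)|²` and let `L` be the circle average of `log F`. As `X_W(0) =
1`, Jensen's formula makes the circle average of `log |X_W|` nonnegative, and at least `log (R/r)`
when there is a zero in `|z| < r`. Twice that average is at most `Y = avg(|X_W|²/F) - 1 + L`, a
nonnegative variable of mean `L`. Markov's inequality for `Y` bounds the probability by `L / (2 log
(R/r))`, and no expectation of a random logarithm is needed. -/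

namespace PermanentUniversality

/-! ### Moments of one entry under the exponential tilt -/

section Tilt

variable {Ω : Type*} [MeasurableSpace Ω]

/-- The exponential weight `e^{-2 Re ζ / N}`. -/
noncomputable def weight (N : ℝ) (ζ : ℂ) : ℝ := Real.exp (-(2 * ζ.re / N))

/-- The mass of the exponentially tilted law of `ζ`. -/
noncomputable def tiltMass (P : Measure Ω) (N : ℝ) (ζ : Ω → ℂ) : ℝ := ∫ ω, weight N (ζ ω) ∂P

/-- The first moment of the exponentially tilted law of `ζ`. -/
noncomputable def tiltMean (P : Measure Ω) (N : ℝ) (ζ : Ω → ℂ) : ℂ :=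
  ∫ ω, (weight N (ζ ω) : ℂ) * ζ ω ∂P

/-- The absolute second moment of the exponentially tilted law of `ζ`. -/
noncomputable def tiltSq (P : Measure Ω) (N : ℝ) (ζ : Ω → ℂ) : ℝ :=
  ∫ ω, weight N (ζ ω) * ‖ζ ω‖ ^ 2 ∂P

lemma weight_pos (N : ℝ) (ζ : ℂ) : 0 < weight N ζ := Real.exp_pos _

lemma continuous_weight (N : ℝ) : Continuous (weight N) := by
  unfold weight
  fun_prop

lemma weight_le_exp {N : ℝ} (hN : 0 < N) (ζ : ℂ) : weight N ζ ≤ Real.exp (2 * ‖ζ‖ / N) := by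
  unfold weight
  gcongr
  rw [← neg_div]
  gcongr
  have := neg_le_of_abs_le (Complex.abs_re_le_norm ζ)
  linarith

lemma weight_le {N : ℝ} (hN : 0 < N) (ζ : ℂ) : weight N ζ ≤ Real.exp (4 * ‖ζ‖ / N) := by
  refine (weight_le_exp hN ζ).trans ?_
  gcongr
  norm_num

lemma abs_exp_sub_one_le_mul_exp (u : ℝ) : |Real.exp u - 1| ≤ |u| * Real.exp |u| := by
  have h := Complex.norm_exp_sub_sum_le_norm_mul_exp (u : ℂ) 1
  simp only [Finset.range_one, Finset.sum_singleton, pow_zero, Nat.factorial_zero, Nat.cast_one,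
    div_one, Complex.norm_real, Real.norm_eq_abs, pow_one] at h
  rwa [← Complex.ofReal_exp, ← Complex.ofReal_one, ← Complex.ofReal_sub, Complex.norm_real,
    Real.norm_eq_abs] at h

lemma abs_exp_sub_linear_le (u : ℝ) : |Real.exp u - (1 + u)| ≤ u ^ 2 * Real.exp |u| := by
  have h := Complex.norm_exp_sub_sum_le_norm_mul_exp (u : ℂ) 2
  simp only [Finset.sum_range_succ, Finset.range_zero, Finset.sum_empty, pow_zero, zero_add,
    Nat.factorial_zero, Nat.cast_one,
    div_one, Complex.norm_real, Real.norm_eq_abs, pow_one, Nat.factorial_one, sq_abs] at h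
  rwa [← Complex.ofReal_exp, ← Complex.ofReal_one, ← Complex.ofReal_add, ← Complex.ofReal_sub,
    Complex.norm_real, Real.norm_eq_abs] at h

lemma exp_le_cubic_add (u : ℝ) :
    Real.exp u ≤ 1 + u + u ^ 2 / 2 + u ^ 3 / 6 + u ^ 4 * Real.exp |u| := by
  have h := Complex.norm_exp_sub_sum_le_norm_mul_exp (u : ℂ) 4
  have e : Complex.exp (u : ℂ) - ∑ m ∈ Finset.range 4, (u : ℂ) ^ m / (m.factorial : ℂ) =
      ((Real.exp u - (1 + u + u ^ 2 / 2 + u ^ 3 / 6) : ℝ) : ℂ) := by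
    simp [Finset.sum_range_succ, Nat.factorial]
  rw [e, Complex.norm_real, Complex.norm_real, Real.norm_eq_abs, Real.norm_eq_abs,
    show |u| ^ 4 = u ^ 4 from (by decide : Even 4).pow_abs u] at h
  linarith [le_of_abs_le h]

/-- Fourth order Taylor expansion of `e^{-2 Re ζ / N} |N + ζ|²`: up to third order, it is the real
part of a polynomial in `ζ`. -/
lemma weight_mul_normSq_le {N : ℝ} (hN : 0 < N) (ζ : ℂ) :
    weight N ζ * ‖(N : ℂ) + ζ‖ ^ 2 - N ^ 2 ≤
      (-ζ ^ 2 + ((2 / (3 * N) : ℝ) : ℂ) * ζ ^ 3).re +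
        22 / N ^ 2 * (‖ζ‖ ^ 4 * Real.exp (4 * ‖ζ‖ / N)) := by
  obtain ⟨y, v, rfl⟩ : ∃ y v : ℝ, ζ = ⟨y, v⟩ := ⟨ζ.re, ζ.im, rfl⟩
  set r := ‖(⟨y, v⟩ : ℂ)‖ with hr
  have hr0 : 0 ≤ r := norm_nonneg _
  have hr2 : r ^ 2 = y ^ 2 + v ^ 2 := by
    rw [hr, ← Complex.normSq_eq_norm_sq, Complex.normSq_apply]; ring
  have hy : |y| ≤ r := Complex.abs_re_le_norm ⟨y, v⟩
  have hsq : ‖(N : ℂ) + (⟨y, v⟩ : ℂ)‖ ^ 2 = N ^ 2 + 2 * N * y + r ^ 2 := by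
    rw [← Complex.normSq_eq_norm_sq, Complex.normSq_apply, hr2]; simp; ring
  -- `Re ζ² = 2y² - r²` and `Re ζ³ = 4y³ - 3r²y`: this identity is what later makes orders two and
  -- three average out on circles.
  have hpoly : (-(⟨y, v⟩ : ℂ) ^ 2 + ((2 / (3 * N) : ℝ) : ℂ) * (⟨y, v⟩ : ℂ) ^ 3).re =
      r ^ 2 - 2 * y ^ 2 + 2 / (3 * N) * (4 * y ^ 3 - 3 * r ^ 2 * y) := by
    rw [hr2]
    rw [Complex.add_re, Complex.neg_re, Complex.re_ofReal_mul]
    simp only [pow_succ, pow_zero, one_mul, Complex.mul_re, Complex.mul_im]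
    ring
  rw [hsq, hpoly]
  have hE1 : 1 ≤ Real.exp (4 * r / N) := Real.one_le_exp (by positivity)
  have hE2 : (N + r) ^ 2 * Real.exp (2 * r / N) ≤ N ^ 2 * Real.exp (4 * r / N) := by
    have h1 : N + r ≤ N * Real.exp (r / N) := by
      have := Real.add_one_le_exp (r / N)
      calc N + r = N * (r / N + 1) := by field_simp; ring
        _ ≤ _ := by gcongr
    calc (N + r) ^ 2 * Real.exp (2 * r / N) ≤ (N * Real.exp (r / N)) ^ 2 * Real.exp (2 * r / N) := by
          gcongr
      _ = N ^ 2 * Real.exp (4 * r / N) := by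
          rw [mul_pow, ← Real.exp_nat_mul, mul_assoc, ← Real.exp_add]
          congr 2; push_cast; ring
  have hE3 : r / N ≤ Real.exp (4 * r / N) := by
    have := Real.add_one_le_exp (4 * r / N)
    have h2 : r / N ≤ 4 * r / N := by gcongr; linarith
    linarith
  set E := Real.exp (4 * r / N) with hE
  have hw : weight N ⟨y, v⟩ ≤ 1 - 2 * y / N + 2 * y ^ 2 / N ^ 2 - 4 / 3 * y ^ 3 / N ^ 3 +
      16 * y ^ 4 / N ^ 4 * Real.exp (2 * r / N) := by
    have h := exp_le_cubic_add (-(2 * y / N))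
    have h2 : Real.exp |-(2 * y / N)| ≤ Real.exp (2 * r / N) := by
      gcongr
      rw [abs_neg, abs_div, abs_mul, abs_of_pos hN, abs_two]
      gcongr
    calc weight N ⟨y, v⟩ ≤ _ := h
      _ ≤ 1 + -(2 * y / N) + (-(2 * y / N)) ^ 2 / 2 + (-(2 * y / N)) ^ 3 / 6 +
          (-(2 * y / N)) ^ 4 * Real.exp (2 * r / N) := by gcongr
      _ = _ := by field_simp; ring
  have hQ0 : 0 ≤ N ^ 2 + 2 * N * y + r ^ 2 := by rw [← hsq]; positivity
  have hQ : N ^ 2 + 2 * N * y + r ^ 2 ≤ (N + r) ^ 2 := by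
    nlinarith [le_of_abs_le hy]
  have hy4 : y ^ 4 ≤ r ^ 4 := by
    rw [← (by decide : Even 4).pow_abs y]; gcongr
  have hmain := mul_le_mul_of_nonneg_right hw hQ0
  have hR : 16 * y ^ 4 / N ^ 4 * Real.exp (2 * r / N) * (N ^ 2 + 2 * N * y + r ^ 2) ≤
      16 / N ^ 2 * (r ^ 4 * E) := by
    calc 16 * y ^ 4 / N ^ 4 * Real.exp (2 * r / N) * (N ^ 2 + 2 * N * y + r ^ 2)
        ≤ 16 * r ^ 4 / N ^ 4 * Real.exp (2 * r / N) * (N + r) ^ 2 := by gcongr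
      _ = 16 * r ^ 4 / N ^ 4 * ((N + r) ^ 2 * Real.exp (2 * r / N)) := by ring
      _ ≤ 16 * r ^ 4 / N ^ 4 * (N ^ 2 * E) := by gcongr
      _ = _ := by field_simp
  have h1 : 2 * y ^ 2 * r ^ 2 / N ^ 2 ≤ 2 / N ^ 2 * (r ^ 4 * E) := by
    have : y ^ 2 ≤ r ^ 2 := by nlinarith [sq_nonneg v]
    calc 2 * y ^ 2 * r ^ 2 / N ^ 2 ≤ 2 * r ^ 2 * r ^ 2 / N ^ 2 := by gcongr
      _ = 2 / N ^ 2 * (r ^ 4 * 1) := by ring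
      _ ≤ _ := by gcongr
  have h2 : -(4 / 3 * y ^ 3 / N ^ 3 * r ^ 2) ≤ 4 / 3 / N ^ 2 * (r ^ 4 * E) := by
    have : -y ^ 3 ≤ r ^ 3 := by
      calc -y ^ 3 ≤ |y ^ 3| := neg_le_abs _
        _ = |y| ^ 3 := abs_pow _ _
        _ ≤ _ := by gcongr
    calc -(4 / 3 * y ^ 3 / N ^ 3 * r ^ 2) = 4 / 3 * (-y ^ 3) / N ^ 3 * r ^ 2 := by ring
      _ ≤ 4 / 3 * r ^ 3 / N ^ 3 * r ^ 2 := by gcongr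
      _ = 4 / 3 / N ^ 2 * (r ^ 4 * (r / N)) := by field_simp
      _ ≤ _ := by gcongr
  have h3 : 0 ≤ 8 / 3 * y ^ 4 / N ^ 2 := by positivity
  have h4 : 0 ≤ 1 / N ^ 2 * (r ^ 4 * E) := by positivity
  -- The term `-8/3 y⁴/N²` is nonpositive and is dropped; the other quartic and higher terms cost `2
  -- + 4/3 + 16 < 22`.
  have hid : (1 - 2 * y / N + 2 * y ^ 2 / N ^ 2 - 4 / 3 * y ^ 3 / N ^ 3 +
      16 * y ^ 4 / N ^ 4 * Real.exp (2 * r / N)) * (N ^ 2 + 2 * N * y + r ^ 2) - N ^ 2 =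
      r ^ 2 - 2 * y ^ 2 + 2 / (3 * N) * (4 * y ^ 3 - 3 * r ^ 2 * y) - 8 / 3 * y ^ 4 / N ^ 2
      + 2 * y ^ 2 * r ^ 2 / N ^ 2 + -(4 / 3 * y ^ 3 / N ^ 3 * r ^ 2) +
      16 * y ^ 4 / N ^ 4 * Real.exp (2 * r / N) * (N ^ 2 + 2 * N * y + r ^ 2) := by
    field_simp
    ring
  have h5 : 22 / N ^ 2 * (r ^ 4 * E) = 22 * (1 / N ^ 2 * (r ^ 4 * E)) := by ring
  have h6 : 16 / N ^ 2 * (r ^ 4 * E) = 16 * (1 / N ^ 2 * (r ^ 4 * E)) := by ring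
  have h7 : 2 / N ^ 2 * (r ^ 4 * E) = 2 * (1 / N ^ 2 * (r ^ 4 * E)) := by ring
  have h8 : 4 / 3 / N ^ 2 * (r ^ 4 * E) = 4 / 3 * (1 / N ^ 2 * (r ^ 4 * E)) := by ring
  rw [h5]
  rw [h6] at hR
  rw [h7] at h1
  rw [h8] at h2
  linarith

/-- `ζ` is a complex random variable whose modulus has exponential moments at scale `a`. -/
structure HasExpMoment (P : Measure Ω) (ζ : Ω → ℂ) (a : ℝ) : Prop where
  measurable : Measurable ζ
  pos : 0 < a
  integrable : Integrable (fun ω => Real.exp (‖ζ ω‖ / a)) P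
  integral_le : ∫ ω, Real.exp (‖ζ ω‖ / a) ∂P ≤ 2

variable {P : Measure Ω} {ζ : Ω → ℂ} {a N : ℝ}

/-- Half of the exponent `r/a` pays for the power `r^k`, the other half for the tilt, since `4/N ≤
1/(2a)`. -/
lemma pow_mul_exp_le {r : ℝ} (hr : 0 ≤ r) (ha : 0 < a) (haN : 8 * a ≤ N) (k : ℕ) :
    r ^ k * Real.exp (4 * r / N) ≤ k.factorial * (2 * a) ^ k * Real.exp (r / a) := by
  have h1 := Real.pow_div_factorial_le_exp (r / (2 * a)) (by positivity) k
  have hk : (0 : ℝ) < k.factorial := by positivity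
  have h2 : r ^ k ≤ k.factorial * (2 * a) ^ k * Real.exp (r / (2 * a)) := by
    rw [div_le_iff₀ hk, div_pow, div_le_iff₀ (by positivity)] at h1
    linarith
  have h3 : Real.exp (4 * r / N) ≤ Real.exp (r / (2 * a)) := by
    rw [Real.exp_le_exp, div_le_div_iff₀ (by linarith) (by positivity)]
    nlinarith
  calc r ^ k * Real.exp (4 * r / N)
      ≤ (k.factorial * (2 * a) ^ k * Real.exp (r / (2 * a))) * Real.exp (r / (2 * a)) := by gcongr
    _ = k.factorial * (2 * a) ^ k * Real.exp (r / a) := by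
      rw [mul_assoc, ← Real.exp_add]; congr 2; field_simp; norm_num

lemma HasExpMoment.integrable_pow_mul_exp (h : HasExpMoment P ζ a) (haN : 8 * a ≤ N) (k : ℕ) :
    Integrable (fun ω => ‖ζ ω‖ ^ k * Real.exp (4 * ‖ζ ω‖ / N)) P := by
  have hm := h.measurable
  refine (h.integrable.const_mul (k.factorial * (2 * a) ^ k)).mono' ?_ ?_
  · exact Measurable.aestronglyMeasurable (by fun_prop)
  · refine .of_forall fun ω => ?_
    rw [Real.norm_of_nonneg (by positivity)]
    exact pow_mul_exp_le (norm_nonneg _) h.pos haN k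

lemma HasExpMoment.integral_pow_mul_exp_le (h : HasExpMoment P ζ a) (haN : 8 * a ≤ N) (k : ℕ) :
    ∫ ω, ‖ζ ω‖ ^ k * Real.exp (4 * ‖ζ ω‖ / N) ∂P ≤ 2 * (k.factorial * (2 * a) ^ k) := by
  have := h.pos
  calc ∫ ω, ‖ζ ω‖ ^ k * Real.exp (4 * ‖ζ ω‖ / N) ∂P
      ≤ ∫ ω, k.factorial * (2 * a) ^ k * Real.exp (‖ζ ω‖ / a) ∂P :=
        integral_mono (h.integrable_pow_mul_exp haN k) (h.integrable.const_mul _)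
          fun ω => pow_mul_exp_le (norm_nonneg _) h.pos haN k
    _ = k.factorial * (2 * a) ^ k * ∫ ω, Real.exp (‖ζ ω‖ / a) ∂P := integral_const_mul _ _
    _ ≤ k.factorial * (2 * a) ^ k * 2 := by gcongr; exact h.integral_le
    _ = _ := by ring

lemma HasExpMoment.integrable_of_norm_le {E : Type*} [NormedAddCommGroup E]
    (h : HasExpMoment P ζ a) (haN : 8 * a ≤ N) (k : ℕ) {f : Ω → E}
    (hf : AEStronglyMeasurable f P)
    (hle : ∀ ω, ‖f ω‖ ≤ ‖ζ ω‖ ^ k * Real.exp (4 * ‖ζ ω‖ / N)) : Integrable f P :=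
  (h.integrable_pow_mul_exp haN k).mono' hf (.of_forall hle)

lemma HasExpMoment.integrable_pow (h : HasExpMoment P ζ a) (k : ℕ) :
    Integrable (fun ω => ζ ω ^ k) P := by
  have hm := h.measurable
  refine h.integrable_of_norm_le le_rfl k (Measurable.aestronglyMeasurable (by fun_prop))
    fun ω => ?_
  have := h.pos
  rw [norm_pow]
  exact le_mul_of_one_le_right (by positivity) (Real.one_le_exp (by positivity))

lemma HasExpMoment.integrable_weight (h : HasExpMoment P ζ a) (haN : 8 * a ≤ N) :
    Integrable (fun ω => weight N (ζ ω)) P := by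
  have hm := h.measurable
  refine h.integrable_of_norm_le haN 0
    ((continuous_weight N).measurable.comp hm).aestronglyMeasurable fun ω => ?_
  rw [Real.norm_of_nonneg (weight_pos _ _).le, pow_zero, one_mul]
  exact weight_le (by linarith [h.pos]) _

lemma HasExpMoment.integrable_weight_mul (h : HasExpMoment P ζ a) (haN : 8 * a ≤ N) :
    Integrable (fun ω => (weight N (ζ ω) : ℂ) * ζ ω) P := by
  have hm := h.measurable
  refine h.integrable_of_norm_le haN 1 ?_ fun ω => ?_
  · have := (continuous_weight N).measurable.comp hm
    exact ((Complex.measurable_ofReal.comp this).mul hm).aestronglyMeasurable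
  rw [norm_mul, Complex.norm_real, Real.norm_of_nonneg (weight_pos _ _).le, pow_one, mul_comm]
  gcongr
  exact weight_le (by linarith [h.pos]) _

lemma HasExpMoment.integrable_weight_mul_sq (h : HasExpMoment P ζ a) (haN : 8 * a ≤ N) :
    Integrable (fun ω => weight N (ζ ω) * ‖ζ ω‖ ^ 2) P := by
  have hm := h.measurable
  refine h.integrable_of_norm_le haN 2 ?_ fun ω => ?_
  · have := (continuous_weight N).measurable.comp hm
    exact (this.mul (hm.norm.pow_const 2)).aestronglyMeasurable
  rw [Real.norm_of_nonneg (mul_nonneg (weight_pos _ _).le (by positivity)), mul_comm]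
  gcongr
  exact weight_le (by linarith [h.pos]) _

/-- Integrate `e^u ≥ 1 + u`; the linear term is centred. The lower bound lets divisions by the mass
be discarded later. -/
lemma HasExpMoment.one_le_tiltMass [IsProbabilityMeasure P] (h : HasExpMoment P ζ a)
    (haN : 8 * a ≤ N) (h0 : ∫ ω, ζ ω ∂P = 0) : 1 ≤ tiltMass P N ζ := by
  have hint : Integrable ζ P := by simpa using h.integrable_pow 1
  have hre : ∫ ω, (ζ ω).re ∂P = 0 := by
    have := integral_re hint
    simpa [h0] using this
  have hre_int : Integrable (fun ω => (ζ ω).re) P := hint.re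
  calc (1 : ℝ) = ∫ ω, (1 - 2 / N * (ζ ω).re) ∂P := by
        rw [integral_sub (integrable_const _) (hre_int.const_mul _), integral_const_mul, hre]
        simp
    _ ≤ tiltMass P N ζ := by
        refine integral_mono ((integrable_const _).sub (hre_int.const_mul _))
          (h.integrable_weight haN) fun ω => ?_
        have := Real.add_one_le_exp (-(2 * (ζ ω).re / N))
        simp only [weight]
        linarith [show 2 / N * (ζ ω).re = 2 * (ζ ω).re / N by ring]

lemma HasExpMoment.tiltMass_le [IsProbabilityMeasure P] (h : HasExpMoment P ζ a)
    (haN : 8 * a ≤ N) (h0 : ∫ ω, ζ ω ∂P = 0) : tiltMass P N ζ ≤ 1 + 64 * a ^ 2 / N ^ 2 := by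
  have hN : 0 < N := by linarith [h.pos]
  have hint : Integrable ζ P := by simpa using h.integrable_pow 1
  have hre : ∫ ω, (ζ ω).re ∂P = 0 := by
    have := integral_re hint
    simpa [h0] using this
  have hre_int : Integrable (fun ω => (ζ ω).re) P := hint.re
  have hM := h.integral_pow_mul_exp_le haN 2
  have hMi := h.integrable_pow_mul_exp haN 2
  have e1 : Integrable (fun ω => 1 - 2 / N * (ζ ω).re) P :=
    (integrable_const _).sub (hre_int.const_mul _)
  calc tiltMass P N ζ
      ≤ ∫ ω, ((1 - 2 / N * (ζ ω).re) +
          4 / N ^ 2 * (‖ζ ω‖ ^ 2 * Real.exp (4 * ‖ζ ω‖ / N))) ∂P := by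
        refine integral_mono (h.integrable_weight haN) (e1.add (hMi.const_mul _)) fun ω => ?_
        have h1 := le_of_abs_le (abs_exp_sub_linear_le (-(2 * (ζ ω).re / N)))
        have h2 : (-(2 * (ζ ω).re / N)) ^ 2 * Real.exp |-(2 * (ζ ω).re / N)| ≤
            4 / N ^ 2 * (‖ζ ω‖ ^ 2 * Real.exp (4 * ‖ζ ω‖ / N)) := by
          have hy := Complex.abs_re_le_norm (ζ ω)
          rw [abs_neg, abs_div, abs_mul, abs_of_pos hN, abs_two, neg_sq, div_pow, mul_pow,
            ← sq_abs (ζ ω).re]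
          calc 2 ^ 2 * |(ζ ω).re| ^ 2 / N ^ 2 * Real.exp (2 * |(ζ ω).re| / N)
              ≤ 2 ^ 2 * ‖ζ ω‖ ^ 2 / N ^ 2 * Real.exp (4 * ‖ζ ω‖ / N) := by
                gcongr
                norm_num
            _ = _ := by ring
        simp only [weight]
        linarith [show 2 / N * (ζ ω).re = 2 * (ζ ω).re / N by ring]
    _ = 1 + 4 / N ^ 2 * ∫ ω, ‖ζ ω‖ ^ 2 * Real.exp (4 * ‖ζ ω‖ / N) ∂P := by
        rw [integral_add e1 (hMi.const_mul _), integral_const_mul,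
          integral_sub (integrable_const _) (hre_int.const_mul _), integral_const_mul, hre]
        simp
    _ ≤ 1 + 4 / N ^ 2 * (2 * (Nat.factorial 2 * (2 * a) ^ 2)) := by gcongr
    _ = _ := by simp [Nat.factorial]; ring

/-- Centring allows the weight to be replaced by the weight minus one, which is of order `|ζ|/N`;
this gains a factor `a/N`. -/
lemma HasExpMoment.norm_tiltMean_le (h : HasExpMoment P ζ a)
    (haN : 8 * a ≤ N) (h0 : ∫ ω, ζ ω ∂P = 0) : ‖tiltMean P N ζ‖ ≤ 32 * a ^ 2 / N := by
  have hN : 0 < N := by linarith [h.pos]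
  have hint : Integrable ζ P := by simpa using h.integrable_pow 1
  have hM := h.integral_pow_mul_exp_le haN 2
  have hMi := h.integrable_pow_mul_exp haN 2
  have e : tiltMean P N ζ = ∫ ω, ((weight N (ζ ω) - 1 : ℝ) : ℂ) * ζ ω ∂P := by
    have : ∀ ω, ((weight N (ζ ω) - 1 : ℝ) : ℂ) * ζ ω = (weight N (ζ ω) : ℂ) * ζ ω - ζ ω := by
      intro ω; push_cast; ring
    simp_rw [this]
    rw [integral_sub (h.integrable_weight_mul haN) hint, h0, sub_zero, tiltMean]
  rw [e]
  calc ‖∫ ω, ((weight N (ζ ω) - 1 : ℝ) : ℂ) * ζ ω ∂P‖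
      ≤ ∫ ω, 2 / N * (‖ζ ω‖ ^ 2 * Real.exp (4 * ‖ζ ω‖ / N)) ∂P := by
        refine norm_integral_le_of_norm_le (hMi.const_mul _) (.of_forall fun ω => ?_)
        rw [norm_mul, Complex.norm_real, Real.norm_eq_abs]
        have h1 := abs_exp_sub_one_le_mul_exp (-(2 * (ζ ω).re / N))
        have hy := Complex.abs_re_le_norm (ζ ω)
        rw [abs_neg, abs_div, abs_mul, abs_of_pos hN, abs_two] at h1
        calc |weight N (ζ ω) - 1| * ‖ζ ω‖
            ≤ (2 * |(ζ ω).re| / N * Real.exp (2 * |(ζ ω).re| / N)) * ‖ζ ω‖ := by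
              gcongr; exact h1
          _ ≤ (2 * ‖ζ ω‖ / N * Real.exp (4 * ‖ζ ω‖ / N)) * ‖ζ ω‖ := by
              gcongr
              norm_num
          _ = _ := by ring
    _ = 2 / N * ∫ ω, ‖ζ ω‖ ^ 2 * Real.exp (4 * ‖ζ ω‖ / N) ∂P := integral_const_mul _ _
    _ ≤ 2 / N * (2 * (Nat.factorial 2 * (2 * a) ^ 2)) := by gcongr
    _ = _ := by simp [Nat.factorial]; ring

lemma tiltSq_nonneg : 0 ≤ tiltSq P N ζ :=
  integral_nonneg fun ω => mul_nonneg (weight_pos _ _).le (by positivity)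

lemma HasExpMoment.tiltSq_le (h : HasExpMoment P ζ a) (haN : 8 * a ≤ N) :
    tiltSq P N ζ ≤ 16 * a ^ 2 := by
  have hN : 0 < N := by linarith [h.pos]
  have hM := h.integral_pow_mul_exp_le haN 2
  calc tiltSq P N ζ ≤ _ := integral_mono (h.integrable_weight_mul_sq haN)
        (h.integrable_pow_mul_exp haN 2) fun ω => by
          simp only
          rw [mul_comm]
          gcongr
          exact weight_le hN _
    _ ≤ _ := hM
    _ = _ := by simp [Nat.factorial]; ring

/-- The left side is `E[weight · |N + ζ|²] - N²`, so the pointwise expansion integrates directly;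
`16896 = 22 · 2 · 4! · 2⁴`. -/
lemma HasExpMoment.tilt_combination_le [IsProbabilityMeasure P] (h : HasExpMoment P ζ a)
    (haN : 8 * a ≤ N) :
    N ^ 2 * (tiltMass P N ζ - 1) + 2 * N * (tiltMean P N ζ).re + tiltSq P N ζ ≤
      (-(∫ ω, ζ ω ^ 2 ∂P) + ((2 / (3 * N) : ℝ) : ℂ) * ∫ ω, ζ ω ^ 3 ∂P).re +
        16896 * a ^ 4 / N ^ 2 := by
  have hN : 0 < N := by linarith [h.pos]
  have hM := h.integral_pow_mul_exp_le haN 4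
  have hMi := h.integrable_pow_mul_exp haN 4
  have i0 := h.integrable_weight haN
  have i1 := h.integrable_weight_mul haN
  have i1' : Integrable (fun ω => ((weight N (ζ ω) : ℂ) * ζ ω).re) P := i1.re
  have i2 := h.integrable_weight_mul_sq haN
  have e1 : (tiltMean P N ζ).re = ∫ ω, ((weight N (ζ ω) : ℂ) * ζ ω).re ∂P :=
    (integral_re i1).symm
  have ip : Integrable (fun ω => -ζ ω ^ 2 + ((2 / (3 * N) : ℝ) : ℂ) * ζ ω ^ 3) P :=
    (h.integrable_pow 2).neg.add ((h.integrable_pow 3).const_mul _)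
  have ip' : Integrable (fun ω => (-ζ ω ^ 2 + ((2 / (3 * N) : ℝ) : ℂ) * ζ ω ^ 3).re) P := ip.re
  have e2 : (-(∫ ω, ζ ω ^ 2 ∂P) + ((2 / (3 * N) : ℝ) : ℂ) * ∫ ω, ζ ω ^ 3 ∂P).re =
      ∫ ω, (-ζ ω ^ 2 + ((2 / (3 * N) : ℝ) : ℂ) * ζ ω ^ 3).re ∂P := by
    have e3 : ∫ ω, (-ζ ω ^ 2 + ((2 / (3 * N) : ℝ) : ℂ) * ζ ω ^ 3) ∂P =
        -(∫ ω, ζ ω ^ 2 ∂P) + ((2 / (3 * N) : ℝ) : ℂ) * ∫ ω, ζ ω ^ 3 ∂P := by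
      have := integral_add (h.integrable_pow 2).neg
        ((h.integrable_pow 3).const_mul ((2 / (3 * N) : ℝ) : ℂ))
      simpa only [Pi.neg_apply, integral_neg, integral_const_mul] using this
    rw [← e3]
    exact (integral_re ip).symm
  have j1 : Integrable (fun ω => N ^ 2 * weight N (ζ ω) - N ^ 2) P :=
    (i0.const_mul _).sub (integrable_const _)
  have j2 : Integrable (fun ω => N ^ 2 * weight N (ζ ω) - N ^ 2 +
      2 * N * ((weight N (ζ ω) : ℂ) * ζ ω).re) P := j1.add (i1'.const_mul _)
  have e4 : N ^ 2 * (tiltMass P N ζ - 1) + 2 * N * (tiltMean P N ζ).re + tiltSq P N ζ =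
      ∫ ω, (N ^ 2 * weight N (ζ ω) - N ^ 2 + 2 * N * ((weight N (ζ ω) : ℂ) * ζ ω).re +
        weight N (ζ ω) * ‖ζ ω‖ ^ 2) ∂P := by
    rw [integral_add j2 i2, integral_add j1 (i1'.const_mul _),
      integral_sub (i0.const_mul _) (integrable_const _), integral_const_mul, integral_const_mul,
      e1, tiltMass, tiltSq]
    simp
    ring
  rw [e4, e2]
  calc _ ≤ ∫ ω, ((-ζ ω ^ 2 + ((2 / (3 * N) : ℝ) : ℂ) * ζ ω ^ 3).re +
        22 / N ^ 2 * (‖ζ ω‖ ^ 4 * Real.exp (4 * ‖ζ ω‖ / N))) ∂P := by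
        refine integral_mono (j2.add i2) (ip'.add (hMi.const_mul _)) fun ω => ?_
        refine le_trans (le_of_eq ?_) (weight_mul_normSq_le hN (ζ ω))
        have : ‖(N : ℂ) + ζ ω‖ ^ 2 = N ^ 2 + 2 * N * (ζ ω).re + ‖ζ ω‖ ^ 2 := by
          rw [← Complex.normSq_eq_norm_sq, ← Complex.normSq_eq_norm_sq, Complex.normSq_apply,
            Complex.normSq_apply]
          simp; ring
        simp only [this, Complex.re_ofReal_mul]
        ring
    _ = _ := integral_add ip' (hMi.const_mul _)
    _ ≤ _ := by
        rw [integral_const_mul]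
        gcongr
        calc _ ≤ 22 / N ^ 2 * (2 * (Nat.factorial 4 * (2 * a) ^ 4)) := by gcongr
          _ = _ := by simp [Nat.factorial]; ring

/-- The logarithm of the second moment, before averaging over the circle. -/
lemma HasExpMoment.log_tilt_le [IsProbabilityMeasure P] (h : HasExpMoment P ζ a)
    (hN : 1 ≤ N) (haN : 128 * a ^ 2 ≤ N) (h0 : ∫ ω, ζ ω ∂P = 0) :
    N ^ 2 * (tiltMass P N ζ - 1) + N * (‖1 + tiltMean P N ζ / tiltMass P N ζ‖ ^ 2 - 1) +
      tiltSq P N ζ / ‖1 + tiltMean P N ζ / tiltMass P N ζ‖ ^ 2 ≤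
      (-(∫ ω, ζ ω ^ 2 ∂P) + ((2 / (3 * N) : ℝ) : ℂ) * ∫ ω, ζ ω ^ 3 ∂P).re +
        25000 * a ^ 4 / N := by
  have ha := h.pos
  -- `32a ≤ 256a² + 1 ≤ 2N + 1 ≤ 3N`.
  have haN' : 8 * a ≤ N := by nlinarith [sq_nonneg (16 * a - 1)]
  have hN0 : 0 < N := by linarith
  have h1 := h.one_le_tiltMass haN' h0
  have h2 := h.tiltMass_le haN' h0
  have h3 := h.norm_tiltMean_le haN' h0
  have h4 := h.tiltSq_le haN'
  have h5 := h.tilt_combination_le haN'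
  have h6 : 0 ≤ tiltSq P N ζ := tiltSq_nonneg
  set m := tiltMass P N ζ
  set d := tiltMean P N ζ
  set q := tiltSq P N ζ
  set T := (-(∫ ω, ζ ω ^ 2 ∂P) + ((2 / (3 * N) : ℝ) : ℂ) * ∫ ω, ζ ω ^ 3 ∂P).re
  set x := ‖d‖ with hx
  have hx0 : 0 ≤ x := norm_nonneg _
  have hm0 : 0 < m := by linarith
  have hx4 : x ≤ 1 / 4 := by
    refine h3.trans ?_
    rw [div_le_div_iff₀ hN0 (by norm_num)]
    linarith
  have hα : ‖1 + d / m‖ ^ 2 = 1 + 2 * d.re / m + x ^ 2 / m ^ 2 := by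
    rw [hx, ← Complex.normSq_eq_norm_sq, ← Complex.normSq_eq_norm_sq, Complex.normSq_apply,
      Complex.normSq_apply]
    simp
    field_simp
    ring
  have hre := neg_le_of_abs_le (Complex.abs_re_le_norm d)
  have hα1 : 1 - 2 * x ≤ ‖1 + d / m‖ ^ 2 := by
    have e1 : -(2 * x) ≤ 2 * d.re / m := by
      rw [le_div_iff₀ hm0]
      nlinarith
    have : 0 ≤ x ^ 2 / m ^ 2 := by positivity
    linarith
  have hterm2 : N * (‖1 + d / m‖ ^ 2 - 1) ≤ 2 * N * d.re + 2 * N * (x * (m - 1)) + N * x ^ 2 := by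
    have e1 : 2 * d.re / m ≤ 2 * d.re + 2 * (x * (m - 1)) := by
      rw [div_le_iff₀ hm0]
      nlinarith [mul_nonneg (mul_nonneg hx0 (sub_nonneg.2 h1)) (sub_nonneg.2 h1),
        mul_nonneg (sub_nonneg.2 h1) (by linarith : 0 ≤ x + d.re)]
    have e2 : x ^ 2 / m ^ 2 ≤ x ^ 2 := div_le_self (by positivity) (one_le_pow₀ h1)
    rw [hα]
    nlinarith
  -- For `0 ≤ x ≤ 1/4`, `(1 + 4x)(1 - 2x) ≥ 1`.
  have hterm3 : q / ‖1 + d / m‖ ^ 2 ≤ q + 4 * (q * x) := by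
    rw [div_le_iff₀ (by linarith)]
    have : 1 ≤ (1 + 4 * x) * ‖1 + d / m‖ ^ 2 := by
      nlinarith [mul_le_mul_of_nonneg_left hα1 (by linarith : 0 ≤ 1 + 4 * x)]
    nlinarith
  have hb1 : 2 * N * (x * (m - 1)) ≤ 4096 * a ^ 4 / N := by
    calc 2 * N * (x * (m - 1)) ≤ 2 * N * (32 * a ^ 2 / N * (64 * a ^ 2 / N ^ 2)) := by
          gcongr; linarith
      _ = 4096 * a ^ 4 / N ^ 2 := by field_simp; norm_num
      _ ≤ 4096 * a ^ 4 / N := by gcongr; nlinarith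
  have hb2 : N * x ^ 2 ≤ 1024 * a ^ 4 / N := by
    calc N * x ^ 2 ≤ N * (32 * a ^ 2 / N) ^ 2 := by gcongr
      _ = _ := by field_simp; norm_num
  have hb3 : 4 * (q * x) ≤ 2048 * a ^ 4 / N := by
    calc 4 * (q * x) ≤ 4 * (16 * a ^ 2 * (32 * a ^ 2 / N)) := by gcongr
      _ = _ := by field_simp; norm_num
  have hb4 : 16896 * a ^ 4 / N ^ 2 ≤ 16896 * a ^ 4 / N := by
    gcongr; nlinarith
  -- The four error terms add up to `24064`; the remaining `936` is slack to a round constant.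
  have hsum : 25000 * a ^ 4 / N = 4096 * a ^ 4 / N + 1024 * a ^ 4 / N + 2048 * a ^ 4 / N +
      16896 * a ^ 4 / N + 936 * a ^ 4 / N := by ring
  have : 0 ≤ 936 * a ^ 4 / N := by positivity
  linarith

end Tilt

/-! ### Fixed points of permutations -/

section PermutationSums

variable {n : ℕ}

lemma card_perm_fixing (S : Finset (Fin n)) :
    (Finset.univ.filter fun π : Equiv.Perm (Fin n) => ∀ i ∈ S, π i = i).card =
      (n - S.card).factorial := by
  have e := Fintype.card_congr (Equiv.Perm.subtypeEquivSubtypePerm fun i : Fin n => i ∉ S)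
  rw [Fintype.card_perm, Fintype.card_subtype_compl, Fintype.card_fin, Fintype.card_coe] at e
  rw [e, Fintype.card_subtype]
  simp

/-- The generating function of the number of fixed points of a permutation. -/
lemma sum_perm_prod_fixed (α q : ℝ) :
    ∑ π : Equiv.Perm (Fin n), ∏ i, (if π i = i then q + α else α) =
      ∑ k ∈ Finset.range (n + 1), n.choose k * (q ^ k * α ^ (n - k) * (n - k).factorial) := by
  have h1 : ∀ π : Equiv.Perm (Fin n), ∏ i, (if π i = i then q + α else α) =
      ∑ t ∈ (Finset.univ : Finset (Fin n)).powerset,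
        if ∀ i ∈ t, π i = i then q ^ t.card * α ^ (n - t.card) else 0 := by
    intro π
    have : ∀ i, (if π i = i then q + α else α) = (if π i = i then q else 0) + α := by
      intro i; split_ifs <;> simp
    simp_rw [this]
    rw [Finset.prod_add]
    refine Finset.sum_congr rfl fun t ht => ?_
    rw [Finset.prod_const, Finset.card_sdiff_of_subset (Finset.subset_univ t), Finset.card_univ,
      Fintype.card_fin, Finset.prod_ite_zero]
    split_ifs <;> simp
  simp_rw [h1]
  rw [Finset.sum_comm]
  have h2 : ∀ t : Finset (Fin n), ∑ π : Equiv.Perm (Fin n),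
      (if ∀ i ∈ t, π i = i then q ^ t.card * α ^ (n - t.card) else 0) =
      q ^ t.card * α ^ (n - t.card) * (n - t.card).factorial := by
    intro t
    rw [← Finset.sum_filter, Finset.sum_const, card_perm_fixing, nsmul_eq_mul, mul_comm]
  simp_rw [h2]
  rw [Finset.sum_powerset_apply_card (fun k => q ^ k * α ^ (n - k) * ((n - k).factorial : ℝ))]
  simp

/-- Since `C(n,k) (n-k)! = n!/k!`, the generating function of fixed points is `n! α^n` times a
truncated exponential series in `q/α`: the Poisson limit as an upper bound. -/
lemma sum_perm_prod_fixed_le {α β q : ℝ} (hα : 0 < α) (hβ : 0 ≤ β) (hq : 0 ≤ q)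
    (hβq : β ≤ q + α) :
    ∑ π : Equiv.Perm (Fin n), ∏ i, (if π i = i then β else α) ≤
      n.factorial * α ^ n * Real.exp (q / α) := by
  calc ∑ π : Equiv.Perm (Fin n), ∏ i, (if π i = i then β else α)
      ≤ ∑ π : Equiv.Perm (Fin n), ∏ i, (if π i = i then q + α else α) := by
        refine Finset.sum_le_sum fun π _ => Finset.prod_le_prod (fun i _ => ?_) fun i _ => ?_
        · split_ifs
          exacts [hβ, hα.le]
        · split_ifs
          exacts [hβq, le_rfl]
    _ = ∑ k ∈ Finset.range (n + 1),
          n.factorial * α ^ n * ((q / α) ^ k / (k.factorial : ℝ)) := by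
        rw [sum_perm_prod_fixed]
        refine Finset.sum_congr rfl fun k hk => ?_
        have hkn : k ≤ n := Nat.lt_succ_iff.1 (Finset.mem_range.1 hk)
        rw [← Nat.choose_mul_factorial_mul_factorial hkn, ← pow_sub_mul_pow α hkn,
          div_pow]
        push_cast
        field_simp
    _ ≤ _ := by
        rw [← Finset.mul_sum]
        gcongr
        exact Real.sum_le_exp_of_nonneg (by positivity) _

end PermutationSums

/-! ### Exact second moment of the reweighted permanent -/

section SecondMoment

variable {Ω : Type*} [MeasurableSpace Ω] {P : Measure Ω}

lemma integrable_prod_of_iIndepFun {ι : Type*} [Fintype ι] {f : ι → Ω → ℂ}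
    (hf : iIndepFun f P) (hint : ∀ i, Integrable (f i) P) :
    Integrable (fun ω => ∏ i, f i ω) P := by
  have := hf.isProbabilityMeasure
  have hm : ∀ i, AEMeasurable (f i) P := fun i => (hint i).aemeasurable
  have key : Integrable (fun x : ι → ℂ => ∏ i, x i) (P.map fun ω i => f i ω) := by
    rw [hf.map_fun_eq_pi_map hm]
    have : ∀ i, IsProbabilityMeasure (P.map (f i)) := fun i =>
      Measure.isProbabilityMeasure_map (hm i)
    refine Integrable.fintype_prod (f := fun _ x => x) fun i => ?_
    exact (integrable_map_measure aestronglyMeasurable_id (hm i)).2 (hint i)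
  exact (integrable_map_measure key.1 (aemeasurable_pi_lambda _ hm)).1 key

/-- The factor contributed by one matrix entry to a term of `|X_A(z)|²`; here `b` and `c` say
whether the entry is used by the first and by the second permutation. -/
noncomputable def entryFactor (N : ℝ) (b c : Prop) [Decidable b] [Decidable c] (ζ : ℂ) : ℂ :=
  (weight N ζ : ℂ) * (if b then 1 + ζ else 1) * (if c then star (1 + ζ) else 1)

/-- `|X_A(z)|²` as a double sum over permutations of products over the entries. -/
lemma normSq_X {n : ℕ} (A : Matrix (Fin n) (Fin n) ℂ) (z : ℂ) :
    ((‖X A z‖ ^ 2 : ℝ) : ℂ) = ((n.factorial : ℂ)⁻¹) ^ 2 *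
      ∑ σ : Equiv.Perm (Fin n), ∑ τ : Equiv.Perm (Fin n), ∏ p : Fin n × Fin n,
        entryFactor n (σ p.2 = p.1) (τ p.2 = p.1) (z * A p.1 p.2) := by
  have hprod : ∀ (σ : Equiv.Perm (Fin n)) (g : Fin n → Fin n → ℂ),
      ∏ p : Fin n × Fin n, (if σ p.2 = p.1 then g p.1 p.2 else 1) = ∏ i, g (σ i) i := by
    intro σ g
    rw [Fintype.prod_prod_type_right]
    refine Finset.prod_congr rfl fun j _ => ?_
    simp
  have hw : ∏ p : Fin n × Fin n, ((weight n (z * A p.1 p.2) : ℝ) : ℂ) =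
      ((‖Complex.exp (-(z * ((n : ℂ)⁻¹ * ∑ i, ∑ j, A i j)))‖ ^ 2 : ℝ) : ℂ) := by
    rw [← Complex.ofReal_prod]
    congr 1
    simp only [weight]
    rw [← Real.exp_sum, Complex.norm_exp, ← Real.exp_nat_mul]
    congr 1
    rw [← Fintype.sum_prod_type' (f := fun i j => A i j), ← mul_assoc, mul_comm z, mul_assoc,
      Finset.mul_sum, Complex.neg_re, ← Complex.ofReal_natCast, ← Complex.ofReal_inv,
      Complex.re_ofReal_mul, Complex.re_sum, Finset.sum_neg_distrib, ← Finset.sum_div,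
      ← Finset.mul_sum]
    push_cast
    ring
  have hterm : ∀ σ τ : Equiv.Perm (Fin n), ∏ p : Fin n × Fin n,
      entryFactor n (σ p.2 = p.1) (τ p.2 = p.1) (z * A p.1 p.2) =
      ((‖Complex.exp (-(z * ((n : ℂ)⁻¹ * ∑ i, ∑ j, A i j)))‖ ^ 2 : ℝ) : ℂ) *
        ((∏ i, (1 + z * A (σ i) i)) * star (∏ i, (1 + z * A (τ i) i))) := by
    intro σ τ
    simp only [entryFactor]
    rw [Finset.prod_mul_distrib, Finset.prod_mul_distrib, hw,
      hprod σ (fun i j => 1 + z * A i j), hprod τ (fun i j => star (1 + z * A i j)), star_prod,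
      mul_assoc]
  simp_rw [hterm, ← Finset.mul_sum]
  have hG : G A z = (n.factorial : ℂ)⁻¹ * ∑ σ : Equiv.Perm (Fin n), ∏ i, (1 + z * A (σ i) i) := by
    simp [G, Matrix.permanent]
  have hss : ∑ σ : Equiv.Perm (Fin n), (∏ i, (1 + z * A (σ i) i)) *
      ∑ τ : Equiv.Perm (Fin n), star (∏ i, (1 + z * A (τ i) i)) =
      ((‖∑ σ : Equiv.Perm (Fin n), ∏ i, (1 + z * A (σ i) i)‖ ^ 2 : ℝ) : ℂ) := by
    rw [← Finset.sum_mul, ← star_sum, Complex.ofReal_pow]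
    exact Complex.mul_conj' _
  rw [hss, X, hG, norm_mul, norm_mul, norm_inv, Complex.norm_natCast]
  push_cast
  ring

lemma continuous_entryFactor (N : ℝ) (b c : Prop) [Decidable b] [Decidable c] :
    Continuous (entryFactor N b c) := by
  unfold entryFactor
  have := continuous_weight N
  split_ifs <;> fun_prop

variable {ζ : Ω → ℂ} {a N : ℝ}

lemma HasExpMoment.integrable_entryFactor (h : HasExpMoment P ζ a) (haN : 8 * a ≤ N)
    (b c : Prop) [Decidable b] [Decidable c] :
    Integrable (fun ω => entryFactor N b c (ζ ω)) P := by
  have hm := h.measurable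
  have hN : 0 < N := by linarith [h.pos]
  refine Integrable.mono' (g := fun ω => ‖ζ ω‖ ^ 0 * Real.exp (4 * ‖ζ ω‖ / N) +
    2 * (‖ζ ω‖ ^ 1 * Real.exp (4 * ‖ζ ω‖ / N)) + ‖ζ ω‖ ^ 2 * Real.exp (4 * ‖ζ ω‖ / N))
    (((h.integrable_pow_mul_exp haN 0).add ((h.integrable_pow_mul_exp haN 1).const_mul 2)).add
      (h.integrable_pow_mul_exp haN 2))
    ((continuous_entryFactor N b c).measurable.comp hm).aestronglyMeasurable
    (.of_forall fun ω => ?_)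
  have hone : ‖1 + ζ ω‖ ≤ 1 + ‖ζ ω‖ := (norm_add_le _ _).trans (by simp)
  have hb : ‖(if b then 1 + ζ ω else 1)‖ ≤ 1 + ‖ζ ω‖ := by
    split_ifs
    exacts [hone, by simp]
  have hc : ‖(if c then star (1 + ζ ω) else 1)‖ ≤ 1 + ‖ζ ω‖ := by
    split_ifs
    · rwa [norm_star]
    · simp
  rw [entryFactor, norm_mul, norm_mul, Complex.norm_real, Real.norm_of_nonneg (weight_pos _ _).le]
  calc weight N (ζ ω) * ‖(if b then 1 + ζ ω else 1)‖ * ‖(if c then star (1 + ζ ω) else 1)‖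
      ≤ Real.exp (4 * ‖ζ ω‖ / N) * (1 + ‖ζ ω‖) * (1 + ‖ζ ω‖) := by
        gcongr
        exact weight_le hN _
    _ = _ := by ring

lemma HasExpMoment.integral_entryFactor (h : HasExpMoment P ζ a) (haN : 8 * a ≤ N)
    (b c : Prop) [Decidable b] [Decidable c] :
    ∫ ω, entryFactor N b c (ζ ω) ∂P =
      if b then
        if c then ((tiltMass P N ζ + 2 * (tiltMean P N ζ).re + tiltSq P N ζ : ℝ) : ℂ)
        else tiltMass P N ζ + tiltMean P N ζ
      else if c then star (tiltMass P N ζ + tiltMean P N ζ) else tiltMass P N ζ := by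
  have i0 : Integrable (fun ω => (weight N (ζ ω) : ℂ)) P := (h.integrable_weight haN).ofReal
  have i1 := h.integrable_weight_mul haN
  have i1s : Integrable (fun ω => star ((weight N (ζ ω) : ℂ) * ζ ω)) P :=
    i1.mono i1.1.star (.of_forall fun ω => (norm_star _).le)
  have i2 : Integrable (fun ω => ((weight N (ζ ω) * ‖ζ ω‖ ^ 2 : ℝ) : ℂ)) P :=
    (h.integrable_weight_mul_sq haN).ofReal
  have e0 : ∫ ω, (weight N (ζ ω) : ℂ) ∂P = tiltMass P N ζ := integral_ofReal
  have e1s : ∫ ω, star ((weight N (ζ ω) : ℂ) * ζ ω) ∂P = star (tiltMean P N ζ) := integral_conj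
  have e2 : ∫ ω, ((weight N (ζ ω) * ‖ζ ω‖ ^ 2 : ℝ) : ℂ) ∂P = tiltSq P N ζ := integral_ofReal
  by_cases hb : b <;> by_cases hc : c <;> simp only [entryFactor, hb, hc, if_true, if_false]
  · have : ∀ ω, (weight N (ζ ω) : ℂ) * (1 + ζ ω) * star (1 + ζ ω) = (weight N (ζ ω) : ℂ) +
        (weight N (ζ ω) : ℂ) * ζ ω + star ((weight N (ζ ω) : ℂ) * ζ ω) +
        ((weight N (ζ ω) * ‖ζ ω‖ ^ 2 : ℝ) : ℂ) := by
      intro ω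
      have := Complex.mul_conj' (ζ ω)
      simp only [star_add, star_one, star_mul', Complex.star_def, Complex.conj_ofReal,
        Complex.ofReal_mul, Complex.ofReal_pow, ← this]
      ring
    simp_rw [this]
    have i01 : Integrable (fun ω => (weight N (ζ ω) : ℂ) + (weight N (ζ ω) : ℂ) * ζ ω) P :=
      i0.add i1
    have i011 : Integrable (fun ω => (weight N (ζ ω) : ℂ) + (weight N (ζ ω) : ℂ) * ζ ω +
      star ((weight N (ζ ω) : ℂ) * ζ ω)) P := i01.add i1s
    rw [integral_add i011 i2, integral_add i01 i1s, integral_add i0 i1, e0, e1s, e2, ← tiltMean]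
    have := Complex.add_conj (tiltMean P N ζ)
    rw [Complex.star_def]
    push_cast at this ⊢
    rw [← this]
    ring
  · have : ∀ ω, (weight N (ζ ω) : ℂ) * (1 + ζ ω) * 1 = (weight N (ζ ω) : ℂ) +
        (weight N (ζ ω) : ℂ) * ζ ω := by intro ω; ring
    simp_rw [this]
    rw [integral_add i0 i1, e0, ← tiltMean]
  · have : ∀ ω, (weight N (ζ ω) : ℂ) * 1 * star (1 + ζ ω) = (weight N (ζ ω) : ℂ) +
        star ((weight N (ζ ω) : ℂ) * ζ ω) := by
      intro ω
      simp only [star_add, star_one, star_mul', Complex.star_def, Complex.conj_ofReal]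
      ring
    simp_rw [this]
    rw [integral_add i0 i1s, e0, e1s, star_add, Complex.star_def, Complex.conj_ofReal]
  · simp only [mul_one]
    rw [e0]

variable {n : ℕ} {W : Ω → Matrix (Fin n) (Fin n) ℂ} {z : ℂ} {m q : ℝ} {d : ℂ}

lemma integrable_prod_entryFactor
    (hW : iIndepFun (fun (p : Fin n × Fin n) ω => W ω p.1 p.2) P)
    (h : ∀ i j, HasExpMoment P (fun ω => z * W ω i j) a) (haN : 8 * a ≤ n)
    (σ τ : Equiv.Perm (Fin n)) :
    Integrable (fun ω => ∏ p : Fin n × Fin n,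
      entryFactor n (σ p.2 = p.1) (τ p.2 = p.1) (z * W ω p.1 p.2)) P := by
  refine integrable_prod_of_iIndepFun
    (hW.comp (fun p w => entryFactor n (σ p.2 = p.1) (τ p.2 = p.1) (z * w)) fun p => ?_)
    fun p => (h p.1 p.2).integrable_entryFactor haN _ _
  exact ((continuous_entryFactor _ _ _).comp (continuous_const_mul z)).measurable

/-- The expectation of a term of the expansion of `|X_W(z)|²`. -/
lemma integral_prod_entryFactor
    (hW : iIndepFun (fun (p : Fin n × Fin n) ω => W ω p.1 p.2) P)
    (h : ∀ i j, HasExpMoment P (fun ω => z * W ω i j) a) (haN : 8 * a ≤ n)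
    (hm : ∀ i j, tiltMass P n (fun ω => z * W ω i j) = m)
    (hd : ∀ i j, tiltMean P n (fun ω => z * W ω i j) = d)
    (hq : ∀ i j, tiltSq P n (fun ω => z * W ω i j) = q) (hm0 : m ≠ 0)
    (σ τ : Equiv.Perm (Fin n)) :
    ∫ ω, ∏ p : Fin n × Fin n,
      entryFactor n (σ p.2 = p.1) (τ p.2 = p.1) (z * W ω p.1 p.2) ∂P =
      ((m ^ (n ^ 2) * ∏ j, if σ j = τ j then 1 + 2 * d.re / m + q / m
        else ‖1 + d / m‖ ^ 2 : ℝ) : ℂ) := by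
  have hm0' : (m : ℂ) ≠ 0 := by exact_mod_cast hm0
  have hi : ∀ p : Fin n × Fin n, ∫ ω, entryFactor n (σ p.2 = p.1) (τ p.2 = p.1)
      (z * W ω p.1 p.2) ∂P = if σ p.2 = p.1 then
        if τ p.2 = p.1 then ((m + 2 * d.re + q : ℝ) : ℂ) else m + d
      else if τ p.2 = p.1 then star (m + d) else m := by
    intro p
    rw [(h p.1 p.2).integral_entryFactor haN, hm, hd, hq]
  have key := (hW.comp (fun p w => entryFactor n (σ p.2 = p.1) (τ p.2 = p.1) (z * w))
    fun p => ((continuous_entryFactor _ _ _).comp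
      (continuous_const_mul z)).measurable).integral_fun_prod_eq_prod_integral
    fun p => ((h p.1 p.2).integrable_entryFactor haN _ _).1
  simp only [Function.comp_def, hi] at key
  refine key.trans ?_
  rw [Fintype.prod_prod_type_right]
  -- In column `j` only the rows `σ j` and `τ j` differ from `m`. If they are distinct, the factors
  -- `1 + d/m` and its conjugate combine into a squared modulus.
  have hcol : ∀ j, ∏ i, (if σ j = i then
        if τ j = i then ((m + 2 * d.re + q : ℝ) : ℂ) else m + d
      else if τ j = i then star (m + d) else m) =
      ((m ^ n * if σ j = τ j then 1 + 2 * d.re / m + q / m else ‖1 + d / m‖ ^ 2 : ℝ) : ℂ) := by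
    intro j
    by_cases hj : σ j = τ j
    · have : ∀ i, (if σ j = i then
          if τ j = i then ((m + 2 * d.re + q : ℝ) : ℂ) else m + d
          else if τ j = i then star (m + d) else m) =
          m * (if σ j = i then ((1 + 2 * d.re / m + q / m : ℝ) : ℂ) else 1) := by
        intro i
        rw [hj]
        split_ifs
        · push_cast; field_simp
        · ring
      simp_rw [this]
      rw [Finset.prod_mul_distrib, Finset.prod_ite_eq, if_pos hj]
      simp
    · have : ∀ i, (if σ j = i then
          if τ j = i then ((m + 2 * d.re + q : ℝ) : ℂ) else m + d
          else if τ j = i then star (m + d) else m) =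
          m * (if σ j = i then 1 + d / m else 1) * (if τ j = i then star (1 + d / m) else 1) := by
        intro i
        have e : star ((m : ℂ) + d) = m * star (1 + d / m) := by
          simp only [star_add, star_one, star_div₀, Complex.star_def, Complex.conj_ofReal]
          field_simp
        split_ifs with h1 h2 h2
        · exact absurd (h1.trans h2.symm) hj
        · field_simp
        · rw [e]; ring
        · ring
      simp_rw [this]
      rw [Finset.prod_mul_distrib, Finset.prod_mul_distrib, Finset.prod_ite_eq,
        Finset.prod_ite_eq, if_neg hj]
      have := Complex.mul_conj' (1 + d / m)
      simp only [Finset.prod_const, Finset.card_univ, Fintype.card_fin, Finset.mem_univ, if_true,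
        Complex.star_def, mul_assoc, this]
      push_cast
      rfl
  simp_rw [hcol]
  rw [← Complex.ofReal_prod, Finset.prod_mul_distrib, Finset.prod_const, Finset.card_univ,
    Fintype.card_fin, ← pow_mul, sq n]

lemma integrable_normSq_X
    (hW : iIndepFun (fun (p : Fin n × Fin n) ω => W ω p.1 p.2) P)
    (h : ∀ i j, HasExpMoment P (fun ω => z * W ω i j) a) (haN : 8 * a ≤ n) :
    Integrable (fun ω => ‖X (W ω) z‖ ^ 2) P := by
  have : Integrable (fun ω => ((‖X (W ω) z‖ ^ 2 : ℝ) : ℂ)) P := by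
    simp_rw [normSq_X]
    exact (integrable_finsetSum _ fun σ _ => integrable_finsetSum _ fun τ _ =>
      integrable_prod_entryFactor hW h haN σ τ).const_mul _
  exact this.re

/-- The exact second moment of `X_W(z)`. -/
lemma integral_normSq_X
    (hW : iIndepFun (fun (p : Fin n × Fin n) ω => W ω p.1 p.2) P)
    (h : ∀ i j, HasExpMoment P (fun ω => z * W ω i j) a) (haN : 8 * a ≤ n)
    (hm : ∀ i j, tiltMass P n (fun ω => z * W ω i j) = m)
    (hd : ∀ i j, tiltMean P n (fun ω => z * W ω i j) = d)
    (hq : ∀ i j, tiltSq P n (fun ω => z * W ω i j) = q) (hm0 : m ≠ 0) :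
    ∫ ω, ‖X (W ω) z‖ ^ 2 ∂P = m ^ (n ^ 2) * ((n.factorial : ℝ)⁻¹ *
      ∑ π : Equiv.Perm (Fin n), ∏ i, if π i = i then 1 + 2 * d.re / m + q / m
        else ‖1 + d / m‖ ^ 2) := by
  apply Complex.ofReal_injective
  rw [← integral_complex_ofReal]
  simp_rw [normSq_X]
  rw [integral_const_mul, integral_finsetSum _ fun σ _ => integrable_finsetSum _ fun τ _ =>
      integrable_prod_entryFactor hW h haN σ τ]
  simp_rw [integral_finsetSum _ fun τ _ => integrable_prod_entryFactor hW h haN _ τ,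
    integral_prod_entryFactor hW h haN hm hd hq hm0]
  simp_rw [← Complex.ofReal_sum, ← Finset.mul_sum]
  rw [Finset.sum_comm]
  -- Writing `σ = τπ` turns coincidences of `σ` and `τ` into fixed points of `π`, so the inner sum
  -- does not depend on `τ`.
  have hτ : ∀ τ : Equiv.Perm (Fin n), ∑ σ : Equiv.Perm (Fin n),
      ∏ j, (if σ j = τ j then 1 + 2 * d.re / m + q / m else ‖1 + d / m‖ ^ 2) =
      ∑ π : Equiv.Perm (Fin n), ∏ i, (if π i = i then 1 + 2 * d.re / m + q / m
        else ‖1 + d / m‖ ^ 2) := by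
    intro τ
    rw [← Equiv.sum_comp (Equiv.mulLeft τ)]
    simp
  simp_rw [hτ]
  rw [Finset.sum_const, Finset.card_univ, Fintype.card_perm, Fintype.card_fin, nsmul_eq_mul]
  have : (n.factorial : ℂ) ≠ 0 := by exact_mod_cast n.factorial_ne_zero
  push_cast
  field_simp

end SecondMoment

/-! ### Jensen's formula and zeros near the origin -/

section Jensen

open Metric MeromorphicOn

variable {f : ℂ → ℂ} {R : ℝ}

/-- An analytic function has no poles, and zeros in the disk have modulus at most `R`. All terms of
Jensen's formula are thus nonnegative, so any single one bounds the sum from below. -/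
lemma divisor_mul_log_nonneg (hR : 0 < R) (hf : AnalyticOnNhd ℂ f (closedBall 0 |R|))
    (u : ℂ) :
    0 ≤ (divisor f (closedBall 0 |R|) u : ℝ) * Real.log (R * ‖0 - u‖⁻¹) := by
  by_cases hu : u ∈ closedBall (0 : ℂ) |R|
  · refine mul_nonneg (mod_cast hf.divisor_nonneg u) ?_
    rw [mem_closedBall_zero_iff, abs_of_pos hR] at hu
    rcases eq_or_ne u 0 with rfl | hu0
    · simp
    · apply Real.log_nonneg
      have : 0 < ‖u‖ := norm_pos_iff.2 hu0
      rw [zero_sub, norm_neg, ← div_eq_mul_inv]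
      exact (one_le_div this).2 hu
  · simp [hu]

lemma circleAverage_log_norm_nonneg (hR : 0 < R) (hf : AnalyticOnNhd ℂ f (closedBall 0 |R|))
    (h0 : f 0 = 1) : 0 ≤ Real.circleAverage (fun z => Real.log ‖f z‖) 0 R := by
  have h0' : f 0 ≠ 0 := by simp [h0]
  rw [hf.circleAverage_log_norm hR.ne' h0', h0, norm_one, Real.log_one, add_zero]
  exact finsum_nonneg fun u => divisor_mul_log_nonneg hR hf u

/-- A zero of `f` near the origin forces a large circle average of `log |f|`. -/
lemma log_div_le_circleAverage_log_norm (hR : 0 < R)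
    (hf : AnalyticOnNhd ℂ f (closedBall 0 |R|))
    (h0 : f 0 = 1) {w : ℂ} (hw : ‖w‖ < R) (hfw : f w = 0) :
    Real.log (R / ‖w‖) ≤ Real.circleAverage (fun z => Real.log ‖f z‖) 0 R := by
  have h0' : f 0 ≠ 0 := by simp [h0]
  have hwR : w ∈ closedBall (0 : ℂ) |R| := by
    rw [mem_closedBall_zero_iff, abs_of_pos hR]; exact hw.le
  rw [hf.circleAverage_log_norm hR.ne' h0', h0, norm_one, Real.log_one, add_zero]
  have hfin : (Function.support fun u => (divisor f (closedBall 0 |R|) u : ℝ) *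
      Real.log (R * ‖0 - u‖⁻¹)).Finite :=
    ((divisor f (closedBall 0 |R|)).finiteSupport (isCompact_closedBall ..)).subset
      fun u hu => by
        simp only [Function.mem_support, ne_eq, mul_eq_zero, not_or, Int.cast_eq_zero] at hu ⊢
        exact hu.1
  have hle : (divisor f (closedBall 0 |R|) w : ℝ) * Real.log (R * ‖0 - w‖⁻¹) ≤
      ∑ᶠ u, (divisor f (closedBall 0 |R|) u : ℝ) * Real.log (R * ‖0 - u‖⁻¹) :=
    single_le_finsum w hfin fun u => divisor_mul_log_nonneg hR hf u
  refine le_trans ?_ hle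
  have hw0 : w ≠ 0 := by rintro rfl; exact h0' hfw
  have hlog : 0 ≤ Real.log (R / ‖w‖) :=
    Real.log_nonneg ((one_le_div (norm_pos_iff.2 hw0)).2 hw.le)
  rw [zero_sub, norm_neg, ← div_eq_mul_inv]
  refine le_mul_of_one_le_left hlog ?_
  have hord0 : analyticOrderAt f w ≠ 0 := (hf w hwR).analyticOrderAt_ne_zero.2 hfw
  -- Infinite order must be excluded because `untop₀` sends `⊤` to `0`; by the identity theorem it
  -- would force `f 0 = 0`.
  have hordtop : analyticOrderAt f w ≠ ⊤ := by
    intro htop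
    rw [analyticOrderAt_eq_top] at htop
    exact h0' (hf.eqOn_zero_of_preconnected_of_eventuallyEq_zero
      (convex_closedBall _ _).isPreconnected hwR htop (by simp))
  rw [hf.divisor_apply hwR]
  obtain ⟨k, hk⟩ := ENat.ne_top_iff_exists.1 hordtop
  rw [← hk] at hord0 ⊢
  have hk1 : 1 ≤ k := Nat.one_le_iff_ne_zero.2 (by exact_mod_cast hord0)
  have : (((k : ℕ∞).map ((↑) : ℕ → ℤ)).untop₀ : ℤ) = k := rfl
  rw [this]
  exact_mod_cast hk1

/-- This is `log x ≤ x - 1` at `x = ‖w‖²/b`, to be used with `b` the second moment. -/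
lemma two_mul_log_norm_le {w : ℂ} (hw : w ≠ 0) {b : ℝ} (hb : 0 < b) :
    2 * Real.log ‖w‖ ≤ ‖w‖ ^ 2 / b - 1 + Real.log b := by
  have hw' : 0 < ‖w‖ := norm_pos_iff.2 hw
  have h := Real.log_le_sub_one_of_pos (show 0 < ‖w‖ ^ 2 / b by positivity)
  rw [Real.log_div (by positivity) hb.ne', Real.log_pow] at h
  push_cast at h
  linarith

/-- Pathwise form of the concavity of the logarithm. -/
lemma two_mul_circleAverage_log_norm_le {F : ℂ → ℝ} (hR : 0 < R) (hf : Differentiable ℂ f)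
    (h0 : f 0 = 1) (hF : ContinuousOn F (sphere 0 R)) (hFpos : ∀ z ∈ sphere (0 : ℂ) R, 0 < F z) :
    2 * Real.circleAverage (fun z => Real.log ‖f z‖) 0 R ≤
      Real.circleAverage (fun z => ‖f z‖ ^ 2 / F z) 0 R - 1 +
        Real.circleAverage (fun z => Real.log (F z)) 0 R := by
  have hfa : AnalyticOnNhd ℂ f Set.univ := fun z _ => hf.analyticAt z
  have hR' : |R| = R := abs_of_pos hR
  have i1 : CircleIntegrable (fun z => Real.log ‖f z‖) 0 R :=
    MeromorphicOn.circleIntegrable_log_norm fun z _ => (hf.analyticAt z).meromorphicAt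
  have i1' : CircleIntegrable (fun z => 2 * Real.log ‖f z‖) 0 R := i1.const_fun_smul (a := (2 : ℝ))
  have i2 : CircleIntegrable (fun z => ‖f z‖ ^ 2 / F z) 0 R := by
    refine ContinuousOn.circleIntegrable hR.le ?_
    exact ((hf.continuous.norm.pow 2).continuousOn).div hF fun z hz => (hFpos z hz).ne'
  have i3 : CircleIntegrable (fun z => Real.log (F z)) 0 R :=
    ContinuousOn.circleIntegrable hR.le (hF.log fun z hz => (hFpos z hz).ne')
  have ic : CircleIntegrable (fun _ : ℂ => (1 : ℝ)) 0 R := circleIntegrable_const 1 0 R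
  have i23 : CircleIntegrable (fun z => ‖f z‖ ^ 2 / F z - 1 + Real.log (F z)) 0 R :=
    (i2.sub ic).add i3
  -- At a zero of `f` on the circle the convention `log 0 = 0` can break the pointwise bound. Zeros
  -- are isolated, so the integrand may be changed there without affecting the average.
  have hcod : ∀ᶠ z in Filter.codiscreteWithin (sphere (0 : ℂ) |R|), f z ≠ 0 := by
    have := hfa.preimage_zero_mem_codiscrete (x := 0) (by simp [h0])
    exact Filter.codiscreteWithin_mono (Set.subset_univ _) this
  classical
  have hcongr : (fun z => 2 * Real.log ‖f z‖) =ᶠ[Filter.codiscreteWithin (sphere (0 : ℂ) |R|)]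
      fun z => if f z = 0 then ‖f z‖ ^ 2 / F z - 1 + Real.log (F z) else 2 * Real.log ‖f z‖ := by
    filter_upwards [hcod] with z hz
    rw [if_neg hz]
  calc 2 * Real.circleAverage (fun z => Real.log ‖f z‖) 0 R
      = Real.circleAverage (fun z => 2 * Real.log ‖f z‖) 0 R :=
        (Real.circleAverage_fun_smul (a := (2 : ℝ))).symm
    _ = Real.circleAverage (fun z => if f z = 0 then ‖f z‖ ^ 2 / F z - 1 + Real.log (F z)
          else 2 * Real.log ‖f z‖) 0 R :=
        Real.circleAverage_congr_codiscreteWithin hcongr hR.ne'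
    _ ≤ Real.circleAverage (fun z => ‖f z‖ ^ 2 / F z - 1 + Real.log (F z)) 0 R := by
        refine Real.circleAverage_mono (i1'.congr_codiscreteWithin hcongr) i23 fun z hz => ?_
        split_ifs with hz0
        · exact le_rfl
        · rw [hR'] at hz
          exact two_mul_log_norm_le hz0 (hFpos z hz)
    _ = _ := by
        have e1 := Real.circleAverage_fun_add (i2.sub ic) i3
        have e2 := Real.circleAverage_fun_sub i2 ic
        rw [Real.circleAverage_const] at e2
        rw [← e2]
        exact e1

end Jensen

/-! ### From the averaged second moment to a zero-free disk -/

section JensenMarkov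

open Metric

variable {Ω : Type*} [MeasurableSpace Ω] {P : Measure Ω} [IsProbabilityMeasure P]

lemma measurable_uncurry_circleMap {f : Ω → ℂ → ℂ} {R : ℝ} (hf : ∀ ω, Continuous (f ω))
    (hm : ∀ z, Measurable fun ω => f ω z) :
    Measurable (Function.uncurry fun (θ : ℝ) (ω : Ω) => f ω (circleMap 0 R θ)) :=
  measurable_uncurry_of_continuous_of_measurable
    (u := fun (θ : ℝ) (ω : Ω) => f ω (circleMap 0 R θ))
    (fun ω => (hf ω).comp (continuous_circleMap 0 R)) fun _ => hm _

/-- A random entire function normalised at the origin has no zero in a small disk, with a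
probability controlled by the circle average of the logarithm of its second moment. -/
lemma measureReal_exists_zero_le {f : Ω → ℂ → ℂ} {r R : ℝ} (hr : 0 < r) (hrR : r < R)
    (hf : ∀ ω, Differentiable ℂ (f ω)) (hm : ∀ z, Measurable fun ω => f ω z)
    (h0 : ∀ ω, f ω 0 = 1)
    (hint : ∀ z ∈ sphere (0 : ℂ) R, Integrable (fun ω => ‖f ω z‖ ^ 2) P)
    (hpos : ∀ z ∈ sphere (0 : ℂ) R, 0 < ∫ ω, ‖f ω z‖ ^ 2 ∂P)
    (hcont : ContinuousOn (fun z => ∫ ω, ‖f ω z‖ ^ 2 ∂P) (sphere 0 R)) :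
    P.real {ω | ∃ z : ℂ, ‖z‖ < r ∧ f ω z = 0} ≤
      Real.circleAverage (fun z => Real.log (∫ ω, ‖f ω z‖ ^ 2 ∂P)) 0 R /
        (2 * Real.log (R / r)) := by
  have hR : 0 < R := hr.trans hrR
  set F : ℂ → ℝ := fun z => ∫ ω, ‖f ω z‖ ^ 2 ∂P with hF
  set L := Real.circleAverage (fun z => Real.log (F z)) 0 R with hL
  set Y : Ω → ℝ := fun ω => Real.circleAverage (fun z => ‖f ω z‖ ^ 2 / F z) 0 R - 1 + L with hY
  have hlog : 0 < Real.log (R / r) := Real.log_pos ((one_lt_div hr).2 hrR)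
  have hfa : ∀ ω, AnalyticOnNhd ℂ (f ω) (closedBall 0 |R|) := fun ω z _ => (hf ω).analyticAt z
  have hYle : ∀ ω, 2 * Real.circleAverage (fun z => Real.log ‖f ω z‖) 0 R ≤ Y ω := fun ω =>
    two_mul_circleAverage_log_norm_le hR (hf ω) (h0 ω) hcont hpos
  have hY0 : ∀ ω, 0 ≤ Y ω := fun ω => by
    have := circleAverage_log_norm_nonneg hR (hfa ω) (h0 ω)
    linarith [hYle ω]
  have hsub : {ω | ∃ z : ℂ, ‖z‖ < r ∧ f ω z = 0} ⊆ {ω | 2 * Real.log (R / r) ≤ Y ω} := by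
    rintro ω ⟨z, hz, hfz⟩
    have h1 := log_div_le_circleAverage_log_norm hR (hfa ω) (h0 ω) (hz.trans hrR) hfz
    have hz0 : 0 < ‖z‖ := by
      rw [norm_pos_iff]
      rintro rfl
      simp [h0 ω] at hfz
    have h2 : Real.log (R / r) ≤ Real.log (R / ‖z‖) := by gcongr
    have := hYle ω
    simp only [Set.mem_ofPred_eq]
    linarith
  have hsph : ∀ θ, circleMap 0 R θ ∈ sphere (0 : ℂ) R := circleMap_mem_sphere 0 hR.le
  have hFc : Continuous fun θ => F (circleMap 0 R θ) :=
    hcont.comp_continuous (continuous_circleMap 0 R) hsph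
  -- The integrand is nonnegative and its integral over `ω` is `1` for every angle, which justifies
  -- Fubini.
  have hjoint : Integrable (Function.uncurry fun (θ : ℝ) (ω : Ω) =>
      ‖f ω (circleMap 0 R θ)‖ ^ 2 / F (circleMap 0 R θ))
      ((volume.restrict (Set.uIoc 0 (2 * Real.pi))).prod P) := by
    have hmeas : Measurable (Function.uncurry fun (θ : ℝ) (ω : Ω) =>
        ‖f ω (circleMap 0 R θ)‖ ^ 2 / F (circleMap 0 R θ)) := by
      have h1 := measurable_uncurry_circleMap (R := R) (fun ω => (hf ω).continuous) hm
      exact (h1.norm.pow_const 2).div (hFc.measurable.comp measurable_fst)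
    rw [integrable_prod_iff hmeas.aestronglyMeasurable]
    constructor
    · exact .of_forall fun θ => (hint _ (hsph θ)).div_const (F (circleMap 0 R θ))
    · have : ∀ θ : ℝ, ∫ ω, ‖Function.uncurry (fun (θ : ℝ) (ω : Ω) =>
          ‖f ω (circleMap 0 R θ)‖ ^ 2 / F (circleMap 0 R θ)) (θ, ω)‖ ∂P = 1 := by
        intro θ
        have hp := hpos _ (hsph θ)
        have : ∀ ω, ‖Function.uncurry (fun (θ : ℝ) (ω : Ω) =>
          ‖f ω (circleMap 0 R θ)‖ ^ 2 / F (circleMap 0 R θ)) (θ, ω)‖ =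
          ‖f ω (circleMap 0 R θ)‖ ^ 2 / F (circleMap 0 R θ) := fun ω =>
            Real.norm_of_nonneg (div_nonneg (by positivity) hp.le)
        simp_rw [this]
        rw [integral_div]
        exact div_self hp.ne'
      simp_rw [this]
      have : IsFiniteMeasure (volume.restrict (Set.uIoc 0 (2 * Real.pi))) := by
        rw [Set.uIoc]
        infer_instance
      exact integrable_const _
  have hmean : ∫ ω, Real.circleAverage (fun z => ‖f ω z‖ ^ 2 / F z) 0 R ∂P = 1 := by
    simp only [Real.circleAverage, smul_eq_mul]
    rw [integral_const_mul, ← intervalIntegral_integral_swap hjoint]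
    have : ∀ θ : ℝ, ∫ ω, ‖f ω (circleMap 0 R θ)‖ ^ 2 / F (circleMap 0 R θ) ∂P = 1 := by
      intro θ
      rw [integral_div]
      exact div_self (hpos _ (hsph θ)).ne'
    simp_rw [this]
    rw [intervalIntegral.integral_const, smul_eq_mul, mul_one, sub_zero]
    exact inv_mul_cancel₀ Real.two_pi_pos.ne'
  -- A non-integrable function has integral `0` by convention, so the value `1` already proves
  -- integrability.
  have hYint0 : Integrable (fun ω => Real.circleAverage (fun z => ‖f ω z‖ ^ 2 / F z) 0 R) P := by
    by_contra hcon
    rw [integral_undef hcon] at hmean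
    exact zero_ne_one hmean
  have hYint : Integrable Y P := (hYint0.sub (integrable_const 1)).add (integrable_const L)
  have hYmean : ∫ ω, Y ω ∂P = L := by
    have e1 : Integrable (fun ω => Real.circleAverage (fun z => ‖f ω z‖ ^ 2 / F z) 0 R - 1) P :=
      hYint0.sub (integrable_const 1)
    rw [hY, integral_add e1 (integrable_const L), integral_sub hYint0 (integrable_const 1), hmean]
    simp
  have hmarkov := mul_meas_ge_le_integral_of_nonneg (.of_forall hY0) hYint (2 * Real.log (R / r))
  rw [hYmean] at hmarkov
  rw [le_div_iff₀ (by positivity), mul_comm]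
  refine le_trans ?_ hmarkov
  gcongr
  exact measure_ne_top _ _

end JensenMarkov

/-! ### From `ψ₁` norms to exponential moments of the modulus -/

section Assembly

variable {Ω : Type*} [MeasurableSpace Ω] {P : Measure Ω}

lemma lintegral_exp_le_of_psi1Norm_lt {Y : Ω → ℝ} {s : ℝ}
    (h : psi1Norm P Y < ENNReal.ofReal s) :
    ∫⁻ ω, ENNReal.ofReal (Real.exp (|Y ω| / s)) ∂P ≤ 2 := by
  simp only [psi1Norm, iInf_lt_iff] at h
  obtain ⟨t, ht, hle, hts⟩ := h
  refine le_trans (lintegral_mono fun ω => ?_) hle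
  gcongr
  exact (ENNReal.ofReal_lt_ofReal_iff_of_nonneg ht.le).1 hts |>.le

/-- Bound `‖ζ‖` by `|Re ζ| + |Im ζ|` and use `xy ≤ (x² + y²)/2`, which needs no independence of the
two parts; the squares are why the scale doubles. -/
lemma hasExpMoment_of_lintegral_le {ζ : Ω → ℂ} {s : ℝ} (hζ : Measurable ζ) (hs : 0 < s)
    (hre : ∫⁻ ω, ENNReal.ofReal (Real.exp (|(ζ ω).re| / s)) ∂P ≤ 2)
    (him : ∫⁻ ω, ENNReal.ofReal (Real.exp (|(ζ ω).im| / s)) ∂P ≤ 2) :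
    HasExpMoment P ζ (2 * s) := by
  have key : ∀ {g : Ω → ℝ}, Measurable g →
      ∫⁻ ω, ENNReal.ofReal (Real.exp (|g ω| / s)) ∂P ≤ 2 →
      Integrable (fun ω => Real.exp (|g ω| / s)) P ∧ ∫ ω, Real.exp (|g ω| / s) ∂P ≤ 2 := by
    intro g hg hle
    have hm : AEStronglyMeasurable (fun ω => Real.exp (|g ω| / s)) P :=
      Measurable.aestronglyMeasurable (by fun_prop)
    have h0 : 0 ≤ᵐ[P] fun ω => Real.exp (|g ω| / s) := .of_forall fun ω => (Real.exp_pos _).le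
    refine ⟨⟨hm, ?_⟩, ?_⟩
    · rw [hasFiniteIntegral_iff_ofReal h0]
      exact hle.trans_lt (by simp)
    · rw [integral_eq_lintegral_of_nonneg_ae h0 hm]
      exact ENNReal.toReal_le_of_le_ofReal (by norm_num) (by simpa using hle)
  obtain ⟨i1, b1⟩ := key (by fun_prop : Measurable fun ω => (ζ ω).re) hre
  obtain ⟨i2, b2⟩ := key (by fun_prop : Measurable fun ω => (ζ ω).im) him
  have hpt : ∀ ω, Real.exp (‖ζ ω‖ / (2 * s)) ≤
      1 / 2 * Real.exp (|(ζ ω).re| / s) + 1 / 2 * Real.exp (|(ζ ω).im| / s) := by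
    intro ω
    have h1 : Real.exp (‖ζ ω‖ / (2 * s)) ≤
        Real.exp (|(ζ ω).re| / s / 2) * Real.exp (|(ζ ω).im| / s / 2) := by
      rw [← Real.exp_add, ← add_div, ← add_div, div_div, mul_comm s 2]
      gcongr
      exact Complex.norm_le_abs_re_add_abs_im _
    have h2 : ∀ x : ℝ, Real.exp x = Real.exp (x / 2) ^ 2 := fun x => by
      rw [← Real.exp_nat_mul]; congr 1; push_cast; ring
    rw [h2 (|(ζ ω).re| / s), h2 (|(ζ ω).im| / s)]
    nlinarith [sq_nonneg (Real.exp (|(ζ ω).re| / s / 2) - Real.exp (|(ζ ω).im| / s / 2))]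
  have i12 : Integrable (fun ω => 1 / 2 * Real.exp (|(ζ ω).re| / s) +
      1 / 2 * Real.exp (|(ζ ω).im| / s)) P := (i1.const_mul _).add (i2.const_mul _)
  have i : Integrable (fun ω => Real.exp (‖ζ ω‖ / (2 * s))) P :=
    i12.mono' (Measurable.aestronglyMeasurable (by fun_prop)) (.of_forall fun ω => by
      rw [Real.norm_of_nonneg (Real.exp_pos _).le]; exact hpt ω)
  refine ⟨hζ, by positivity, i, ?_⟩
  calc _ ≤ _ := integral_mono i i12 hpt
    _ = 1 / 2 * ∫ ω, Real.exp (|(ζ ω).re| / s) ∂P + 1 / 2 * ∫ ω, Real.exp (|(ζ ω).im| / s) ∂P := by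
        rw [integral_add (i1.const_mul _) (i2.const_mul _), integral_const_mul, integral_const_mul]
    _ ≤ 2 := by linarith

lemma HasExpMoment.const_mul {ζ : Ω → ℂ} {a : ℝ} (h : HasExpMoment P ζ a) {z : ℂ} (hz : z ≠ 0) :
    HasExpMoment P (fun ω => z * ζ ω) (a * ‖z‖) := by
  have hz' : 0 < ‖z‖ := norm_pos_iff.2 hz
  have e : ∀ ω, ‖z * ζ ω‖ / (a * ‖z‖) = ‖ζ ω‖ / a := fun ω => by
    rw [norm_mul, mul_comm a, mul_div_mul_left _ _ hz'.ne']
  exact ⟨h.measurable.const_mul z, mul_pos h.pos hz', by simp_rw [e]; exact h.integrable,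
    by simp_rw [e]; exact h.integral_le⟩

variable {n : ℕ} {W : Ω → Matrix (Fin n) (Fin n) ℂ} {ν K : ℝ}

/-- The directions `φ = 0` and `φ = π/2` give real and imaginary parts. One factor 2 in `4K√ν` makes
the `ψ₁` bound strict, so that an admissible `t` exists below it; the other comes from joining the
two parts. -/
lemma IsSubexponentialIIDMatrix.hasExpMoment (hW : IsSubexponentialIIDMatrix P W ν K)
    (hK : 0 < K) (hν : 0 < ν) (i j : Fin n) :
    HasExpMoment P (fun ω => W ω i j) (4 * K * √ν) := by
  have hs : 0 < K * √ν := mul_pos hK (Real.sqrt_pos.2 hν)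
  have hm := hW.measurable i j
  have hdir : ∀ φ ∈ Set.Ico (0 : ℝ) (2 * Real.pi),
      ∫⁻ ω, ENNReal.ofReal (Real.exp (|(Complex.exp (-(Complex.I * (φ : ℂ))) * W ω i j).re| /
        (2 * (K * √ν)))) ∂P ≤ 2 := by
    intro φ hφ
    refine lintegral_exp_le_of_psi1Norm_lt ?_
    refine lt_of_le_of_lt ((le_iSup₂ (f := fun (φ : ℝ) (_ : φ ∈ Set.Ico (0 : ℝ) (2 * Real.pi)) =>
      psi1Norm P (fun ω => (Complex.exp (-(Complex.I * (φ : ℂ))) * W ω i j).re)) φ hφ).trans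
      (hW.subexponential i j)) ?_
    rw [ENNReal.ofReal_lt_ofReal_iff (by positivity)]
    linarith
  have h := hasExpMoment_of_lintegral_le (P := P) hm (by positivity : 0 < 2 * (K * √ν)) ?_ ?_
  · convert h using 1
    ring
  · simpa using hdir 0 ⟨le_rfl, Real.two_pi_pos⟩
  · have := hdir (Real.pi / 2) ⟨by positivity, by linarith [Real.pi_pos]⟩
    have e : Complex.exp (-(Complex.I * ((Real.pi / 2 : ℝ) : ℂ))) = -Complex.I := by
      rw [Complex.exp_neg, mul_comm]
      push_cast
      rw [Complex.exp_pi_div_two_mul_I, Complex.inv_I]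
    simp only [e] at this
    simpa using this

/-! ### The second moment on a circle -/

variable {ζ : Ω → ℂ} {a N R : ℝ} {z : ℂ}

/-- On the circle `‖zζ‖ = ‖Rζ‖`, so one function dominates for all `z`. -/
lemma HasExpMoment.continuousOn_integral {E : Type*} [NormedAddCommGroup E] [NormedSpace ℝ E]
    (h : HasExpMoment P ζ a) (hR : 0 < R)
    (haN : 8 * (a * R) ≤ N) {g : ℂ → E} (hg : Continuous g) (k : ℕ)
    (hle : ∀ w, ‖g w‖ ≤ ‖w‖ ^ k * Real.exp (4 * ‖w‖ / N)) :
    ContinuousOn (fun z => ∫ ω, g (z * ζ ω) ∂P) (Metric.sphere 0 R) := by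
  have hm := h.measurable
  have hR' : ((R : ℝ) : ℂ) ≠ 0 := by exact_mod_cast hR.ne'
  have hh := h.const_mul hR'
  rw [Complex.norm_real, Real.norm_of_nonneg hR.le] at hh
  refine continuousOn_of_dominated (F := fun z ω => g (z * ζ ω))
    (bound := fun ω => ‖(R : ℂ) * ζ ω‖ ^ k * Real.exp (4 * ‖(R : ℂ) * ζ ω‖ / N)) ?_ ?_ ?_ ?_
  · exact fun z _ => hg.comp_aestronglyMeasurable (hm.const_mul z).aestronglyMeasurable
  · intro z hz
    refine .of_forall fun ω => ?_
    have : ‖(R : ℂ) * ζ ω‖ = ‖z * ζ ω‖ := by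
      rw [norm_mul, norm_mul, mem_sphere_zero_iff_norm.1 hz, Complex.norm_real,
        Real.norm_of_nonneg hR.le]
    rw [this]
    exact hle _
  · exact hh.integrable_pow_mul_exp haN k
  · exact .of_forall fun ω => (hg.comp (continuous_mul_const (ζ ω))).continuousOn

lemma HasExpMoment.continuousOn_tilt (h : HasExpMoment P ζ a) (hR : 0 < R)
    (haN : 8 * (a * R) ≤ N) :
    ContinuousOn (fun z => tiltMass P N fun ω => z * ζ ω) (Metric.sphere 0 R) ∧
    ContinuousOn (fun z => tiltMean P N fun ω => z * ζ ω) (Metric.sphere 0 R) ∧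
    ContinuousOn (fun z => tiltSq P N fun ω => z * ζ ω) (Metric.sphere 0 R) := by
  have hN : 0 < N := by linarith [mul_pos h.pos hR]
  have hc := continuous_weight N
  refine ⟨h.continuousOn_integral hR haN hc 0 fun w => ?_,
    h.continuousOn_integral (g := fun w => (weight N w : ℂ) * w) hR haN (by fun_prop) 1 fun w => ?_,
    h.continuousOn_integral (g := fun w => weight N w * ‖w‖ ^ 2) hR haN (by fun_prop) 2 fun w => ?_⟩
  · rw [Real.norm_of_nonneg (weight_pos _ _).le, pow_zero, one_mul]
    exact weight_le hN w
  · rw [norm_mul, Complex.norm_real, Real.norm_of_nonneg (weight_pos _ _).le, pow_one, mul_comm]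
    gcongr
    exact weight_le hN w
  · rw [Real.norm_of_nonneg (mul_nonneg (weight_pos _ _).le (by positivity)), mul_comm]
    gcongr
    exact weight_le hN w

/-- The common setting of the second moment computations: independent entries with the law of `ζ`,
which is centred and has exponential moments at scale `a`. -/
structure HasIIDEntries (P : Measure Ω) (W : Ω → Matrix (Fin n) (Fin n) ℂ) (ζ : Ω → ℂ) (a : ℝ) :
    Prop where
  indep : iIndepFun (fun (p : Fin n × Fin n) ω => W ω p.1 p.2) P
  identDistrib : ∀ i j, IdentDistrib (fun ω => W ω i j) ζ P P
  expMoment : ∀ i j, HasExpMoment P (fun ω => W ω i j) a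
  expMoment_ref : HasExpMoment P ζ a
  mean_zero : ∫ ω, ζ ω ∂P = 0

namespace HasIIDEntries

lemma integral_comp_eq {E : Type*} [NormedAddCommGroup E] [NormedSpace ℝ E] [MeasurableSpace E]
    [BorelSpace E] (hW : HasIIDEntries P W ζ a) {g : ℂ → E} (hg : Continuous g) (z : ℂ)
    (i j : Fin n) : ∫ ω, g (z * W ω i j) ∂P = ∫ ω, g (z * ζ ω) ∂P :=
  ((hW.identDistrib i j).comp
    (hg.comp (continuous_const_mul z)).measurable).integral_eq

lemma tilt_eq (hW : HasIIDEntries P W ζ a) (N : ℝ) (z : ℂ) (i j : Fin n) :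
    tiltMass P N (fun ω => z * W ω i j) = tiltMass P N (fun ω => z * ζ ω) ∧
    tiltMean P N (fun ω => z * W ω i j) = tiltMean P N (fun ω => z * ζ ω) ∧
    tiltSq P N (fun ω => z * W ω i j) = tiltSq P N (fun ω => z * ζ ω) := by
  have hc := continuous_weight N
  exact ⟨hW.integral_comp_eq hc z i j,
    hW.integral_comp_eq (g := fun w => (weight N w : ℂ) * w) (by fun_prop) z i j,
    hW.integral_comp_eq (g := fun w => weight N w * ‖w‖ ^ 2) (by fun_prop) z i j⟩

lemma ne_zero_of_norm (hR : 0 < R) (hz : ‖z‖ = R) : z ≠ 0 := by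
  rintro rfl
  simp at hz
  exact hR.ne hz

lemma integral_mul_eq_zero (hW : HasIIDEntries P W ζ a) (z : ℂ) : ∫ ω, z * ζ ω ∂P = 0 := by
  rw [integral_const_mul, hW.mean_zero, mul_zero]

variable [IsProbabilityMeasure P]

lemma integral_normSq_X_eq (hW : HasIIDEntries P W ζ a) (hR : 0 < R) (haN : 8 * (a * R) ≤ n)
    (hz : ‖z‖ = R) :
    Integrable (fun ω => ‖X (W ω) z‖ ^ 2) P ∧
    ∫ ω, ‖X (W ω) z‖ ^ 2 ∂P = tiltMass P n (fun ω => z * ζ ω) ^ (n ^ 2) *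
      ((n.factorial : ℝ)⁻¹ * ∑ π : Equiv.Perm (Fin n), ∏ i, if π i = i then
        1 + 2 * (tiltMean P n fun ω => z * ζ ω).re / tiltMass P n (fun ω => z * ζ ω) +
          tiltSq P n (fun ω => z * ζ ω) / tiltMass P n (fun ω => z * ζ ω)
        else ‖1 + (tiltMean P n fun ω => z * ζ ω) / tiltMass P n (fun ω => z * ζ ω)‖ ^ 2) := by
  have hz0 : z ≠ 0 := ne_zero_of_norm hR hz
  have h : ∀ i j, HasExpMoment P (fun ω => z * W ω i j) (a * R) := fun i j => by
    have := (hW.expMoment i j).const_mul hz0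
    rwa [hz] at this
  have href := hW.expMoment_ref.const_mul hz0
  rw [hz] at href
  refine ⟨integrable_normSq_X hW.indep h haN, ?_⟩
  refine integral_normSq_X hW.indep h haN (fun i j => (hW.tilt_eq n z i j).1)
    (fun i j => (hW.tilt_eq n z i j).2.1) (fun i j => (hW.tilt_eq n z i j).2.2) ?_
  exact (lt_of_lt_of_le one_pos (href.one_le_tiltMass haN (hW.integral_mul_eq_zero z))).ne'

/-- The hypothesis forces `‖d‖ ≤ 1/4`, hence both factors are at least `1/2`. The last inequality is
what `sum_perm_prod_fixed_le` requires; it uses `q/m ≤ q`. -/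
lemma secondMoment_factors_pos (hW : HasIIDEntries P W ζ a) (hR : 0 < R) (hn : 1 ≤ n)
    (haN : 128 * (a * R) ^ 2 ≤ n) (hz : ‖z‖ = R) :
    1 ≤ tiltMass P n (fun ω => z * ζ ω) ∧
    0 < 1 + 2 * (tiltMean P n fun ω => z * ζ ω).re / tiltMass P n (fun ω => z * ζ ω) +
          tiltSq P n (fun ω => z * ζ ω) / tiltMass P n (fun ω => z * ζ ω) ∧
    0 < ‖1 + (tiltMean P n fun ω => z * ζ ω) / tiltMass P n (fun ω => z * ζ ω)‖ ^ 2 ∧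
    1 + 2 * (tiltMean P n fun ω => z * ζ ω).re / tiltMass P n (fun ω => z * ζ ω) +
          tiltSq P n (fun ω => z * ζ ω) / tiltMass P n (fun ω => z * ζ ω) ≤
      tiltSq P n (fun ω => z * ζ ω) +
      ‖1 + (tiltMean P n fun ω => z * ζ ω) / tiltMass P n (fun ω => z * ζ ω)‖ ^ 2 := by
  have hz0 : z ≠ 0 := ne_zero_of_norm hR hz
  have h := hW.expMoment_ref.const_mul hz0
  rw [hz] at h
  have hn' : (1 : ℝ) ≤ n := by exact_mod_cast hn
  have haN' : 8 * (a * R) ≤ n := by nlinarith [sq_nonneg (16 * (a * R) - 1)]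
  have h0 := hW.integral_mul_eq_zero z
  have h1 := h.one_le_tiltMass haN' h0
  have h3 := h.norm_tiltMean_le haN' h0
  have h6 : 0 ≤ tiltSq P n (fun ω => z * ζ ω) := tiltSq_nonneg
  set m := tiltMass P n (fun ω => z * ζ ω)
  set d := tiltMean P n (fun ω => z * ζ ω)
  set q := tiltSq P n (fun ω => z * ζ ω)
  have hd : ‖d‖ ≤ 1 / 4 := by
    refine h3.trans ?_
    rw [div_le_div_iff₀ (by linarith) (by norm_num)]
    linarith
  have hm0 : 0 < m := by linarith
  have hre := neg_le_of_abs_le (Complex.abs_re_le_norm d)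
  have hα : ‖1 + d / m‖ ^ 2 = 1 + 2 * d.re / m + ‖d‖ ^ 2 / m ^ 2 := by
    rw [← Complex.normSq_eq_norm_sq, ← Complex.normSq_eq_norm_sq, Complex.normSq_apply,
      Complex.normSq_apply]
    simp
    field_simp
    ring
  have e1 : -(1 / 2) ≤ 2 * d.re / m := by
    rw [le_div_iff₀ hm0]
    nlinarith
  have e2 : 0 ≤ ‖d‖ ^ 2 / m ^ 2 := by positivity
  have e3 : 0 ≤ q / m := by positivity
  have e4 : q / m ≤ q := div_le_self h6 h1
  refine ⟨h1, by linarith, by linarith, by linarith⟩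

lemma integral_normSq_X_pos (hW : HasIIDEntries P W ζ a) (hR : 0 < R) (hn : 1 ≤ n)
    (haN : 128 * (a * R) ^ 2 ≤ n) (hz : ‖z‖ = R) : 0 < ∫ ω, ‖X (W ω) z‖ ^ 2 ∂P := by
  have hn' : (1 : ℝ) ≤ n := by exact_mod_cast hn
  obtain ⟨h1, h2, h3, -⟩ := hW.secondMoment_factors_pos hR hn haN hz
  rw [(hW.integral_normSq_X_eq hR (by nlinarith [sq_nonneg (16 * (a * R) - 1)]) hz).2]
  have : 0 < ∑ π : Equiv.Perm (Fin n), ∏ i, if π i = i then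
        1 + 2 * (tiltMean P n fun ω => z * ζ ω).re / tiltMass P n (fun ω => z * ζ ω) +
          tiltSq P n (fun ω => z * ζ ω) / tiltMass P n (fun ω => z * ζ ω)
        else ‖1 + (tiltMean P n fun ω => z * ζ ω) / tiltMass P n (fun ω => z * ζ ω)‖ ^ 2 := by
    refine Finset.sum_pos (fun π _ => Finset.prod_pos fun i _ => ?_) Finset.univ_nonempty
    split_ifs
    exacts [h2, h3]
  have h1' : 0 < tiltMass P n (fun ω => z * ζ ω) := by linarith
  positivity

lemma log_integral_normSq_X_le (hW : HasIIDEntries P W ζ a) (hR : 0 < R) (hn : 1 ≤ n)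
    (haN : 128 * (a * R) ^ 2 ≤ n) (hz : ‖z‖ = R) :
    Real.log (∫ ω, ‖X (W ω) z‖ ^ 2 ∂P) ≤
      (-(z ^ 2 * ∫ ω, ζ ω ^ 2 ∂P) + ((2 / (3 * n) : ℝ) : ℂ) * (z ^ 3 * ∫ ω, ζ ω ^ 3 ∂P)).re +
        25000 * (a * R) ^ 4 / n := by
  have hn' : (1 : ℝ) ≤ n := by exact_mod_cast hn
  have hz0 : z ≠ 0 := ne_zero_of_norm hR hz
  have h := hW.expMoment_ref.const_mul hz0
  rw [hz] at h
  have hlog := h.log_tilt_le hn' haN (hW.integral_mul_eq_zero z)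
  simp only [mul_pow, integral_const_mul] at hlog ⊢
  refine le_trans ?_ hlog
  have hpos := hW.integral_normSq_X_pos hR hn haN hz
  obtain ⟨h1, h2, h3, h4⟩ := hW.secondMoment_factors_pos hR hn haN hz
  rw [(hW.integral_normSq_X_eq hR (by nlinarith [sq_nonneg (16 * (a * R) - 1)]) hz).2] at hpos ⊢
  have h6 : 0 ≤ tiltSq P n (fun ω => z * ζ ω) := tiltSq_nonneg
  have hsum := sum_perm_prod_fixed_le (n := n) h3 h2.le h6 h4
  set m := tiltMass P n (fun ω => z * ζ ω)
  set d := tiltMean P n (fun ω => z * ζ ω)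
  set q := tiltSq P n (fun ω => z * ζ ω)
  set α := ‖1 + d / m‖ ^ 2
  have hm0 : 0 < m := by linarith
  have hf : (0 : ℝ) < n.factorial := by positivity
  calc _ ≤ Real.log (m ^ (n ^ 2) * ((n.factorial : ℝ)⁻¹ *
        (n.factorial * α ^ n * Real.exp (q / α)))) := by gcongr
    _ = Real.log (m ^ (n ^ 2) * α ^ n * Real.exp (q / α)) := by
        congr 1
        field_simp
    _ = (n : ℝ) ^ 2 * Real.log m + n * Real.log α + q / α := by
        rw [Real.log_mul (by positivity) (by positivity), Real.log_mul (by positivity)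
          (by positivity), Real.log_exp, Real.log_pow, Real.log_pow]
        push_cast
        ring
    _ ≤ _ := by
        gcongr
        · exact Real.log_le_sub_one_of_pos hm0
        · exact Real.log_le_sub_one_of_pos h3

lemma continuousOn_integral_normSq_X (hW : HasIIDEntries P W ζ a) (hR : 0 < R) (hn : 1 ≤ n)
    (haN : 128 * (a * R) ^ 2 ≤ n) :
    ContinuousOn (fun z => ∫ ω, ‖X (W ω) z‖ ^ 2 ∂P) (Metric.sphere 0 R) := by
  have hn' : (1 : ℝ) ≤ n := by exact_mod_cast hn
  have haN' : 8 * (a * R) ≤ n := by nlinarith [sq_nonneg (16 * (a * R) - 1)]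
  obtain ⟨c0, c1, c2⟩ := hW.expMoment_ref.continuousOn_tilt hR haN'
  have hm0 : ∀ z ∈ Metric.sphere (0 : ℂ) R, tiltMass P n (fun ω => z * ζ ω) ≠ 0 := fun z hz => by
    have := (hW.secondMoment_factors_pos hR hn haN (mem_sphere_zero_iff_norm.1 hz)).1
    linarith
  refine ContinuousOn.congr ?_ fun z hz =>
    (hW.integral_normSq_X_eq hR haN' (mem_sphere_zero_iff_norm.1 hz)).2
  refine (c0.pow _).mul (continuousOn_const.mul
    (continuousOn_finsetSum _ fun π _ => continuousOn_finsetProd _ fun i _ => ?_))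
  have c1' : ContinuousOn (fun z => (tiltMean P n fun ω => z * ζ ω).re) (Metric.sphere 0 R) :=
    Complex.continuous_re.comp_continuousOn c1
  have c0' : ContinuousOn (fun z => ((tiltMass P n fun ω => z * ζ ω : ℝ) : ℂ))
      (Metric.sphere 0 R) := Complex.continuous_ofReal.comp_continuousOn c0
  split_ifs
  · exact (continuousOn_const.add ((continuousOn_const.mul c1').div c0 hm0)).add (c2.div c0 hm0)
  · exact (continuousOn_const.add (c1.div c0' fun z hz => by exact_mod_cast hm0 z hz)).norm.pow 2

lemma circleIntegrable_log (hW : HasIIDEntries P W ζ a) (hR : 0 < R) (hn : 1 ≤ n)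
    (haN : 128 * (a * R) ^ 2 ≤ n) :
    CircleIntegrable (fun z => Real.log (∫ ω, ‖X (W ω) z‖ ^ 2 ∂P)) 0 R :=
  ContinuousOn.circleIntegrable hR.le <| (hW.continuousOn_integral_normSq_X hR hn haN).log
    fun _ hz => (hW.integral_normSq_X_pos hR hn haN (mem_sphere_zero_iff_norm.1 hz)).ne'

lemma circleAverage_log_le (hW : HasIIDEntries P W ζ a) (hR : 0 < R) (hn : 1 ≤ n)
    (haN : 128 * (a * R) ^ 2 ≤ n) :
    Real.circleAverage (fun z => Real.log (∫ ω, ‖X (W ω) z‖ ^ 2 ∂P)) 0 R ≤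
      25000 * (a * R) ^ 4 / n := by
  set p : ℂ → ℂ := fun z => -(z ^ 2 * ∫ ω, ζ ω ^ 2 ∂P) +
    ((2 / (3 * n) : ℝ) : ℂ) * (z ^ 3 * ∫ ω, ζ ω ^ 3 ∂P) with hp
  have hpd : Differentiable ℂ p := by fun_prop
  have hpi : CircleIntegrable p 0 R := hpd.continuous.continuousOn.circleIntegrable hR.le
  have hpre : CircleIntegrable (fun z => (p z).re) 0 R :=
    (Complex.continuous_re.comp hpd.continuous).continuousOn.circleIntegrable hR.le
  -- Mean value property: `p` is entire and `p 0 = 0`.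
  have havg : Real.circleAverage (fun z => (p z).re) 0 R = 0 := by
    have h1 := Complex.reCLM.circleAverage_comp_comm hpi
    have h2 : Real.circleAverage p 0 R = p 0 := hpd.diffContOnCl.circleAverage
    rw [h2] at h1
    simpa [hp, Function.comp_def] using h1
  have hci := circleIntegrable_const (25000 * (a * R) ^ 4 / n) (0 : ℂ) R
  calc _ ≤ Real.circleAverage (fun z => (p z).re + 25000 * (a * R) ^ 4 / n) 0 R := by
        refine Real.circleAverage_mono (hW.circleIntegrable_log hR hn haN) (hpre.add hci)
          fun z hz => ?_
        rw [abs_of_pos hR, mem_sphere_zero_iff_norm] at hz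
        exact hW.log_integral_normSq_X_le hR hn haN hz
    _ = _ := by
        have := Real.circleAverage_fun_add hpre hci
        rw [this, havg, Real.circleAverage_const, zero_add]

end HasIIDEntries

/-! ### Translation to the parameters `K` and `ν` -/

lemma IsSubexponentialIIDMatrix.hasIIDEntries (hW : IsSubexponentialIIDMatrix P W ν K)
    (hK : 0 < K) (hν : 0 < ν) (hn : 1 ≤ n) :
    HasIIDEntries P W (fun ω => W ω ⟨0, hn⟩ ⟨0, hn⟩) (4 * K * √ν) where
  indep := hW.indep
  identDistrib i j := hW.identDistrib i j _ _
  expMoment i j := hW.hasExpMoment hK hν i j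
  expMoment_ref := hW.hasExpMoment hK hν _ _
  mean_zero := hW.mean_zero _ _

/-- With scale `a = 4K√ν`, `2048 = 128 · 4²`; likewise `6400000 = 25000 · 4⁴` below. -/
lemma sq_scale_le (hK : 0 < K) (hν : 0 < ν) (hn : 1 ≤ n)
    (h : ν * R ^ 2 / n ≤ 1 / (2048 * K ^ 2)) : 128 * (4 * K * √ν * R) ^ 2 ≤ n := by
  have hn' : (0 : ℝ) < n := by exact_mod_cast hn
  rw [div_le_div_iff₀ hn' (by positivity)] at h
  rw [mul_pow, mul_pow, Real.sq_sqrt hν.le]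
  linarith

lemma pow_four_scale (hν : 0 < ν) :
    25000 * (4 * K * √ν * R) ^ 4 / (n : ℝ) = 6400000 * K ^ 4 * ν ^ 2 * R ^ 4 / n := by
  have : √ν ^ 4 = ν ^ 2 := by
    rw [show √ν ^ 4 = (√ν ^ 2) ^ 2 by ring, Real.sq_sqrt hν.le]
  rw [mul_pow, mul_pow, this]
  ring

lemma differentiable_X (A : Matrix (Fin n) (Fin n) ℂ) : Differentiable ℂ (X A) := by
  unfold X G Matrix.permanent
  simp only [Matrix.add_apply, Matrix.of_apply, Matrix.smul_apply, smul_eq_mul]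
  fun_prop

lemma X_zero (A : Matrix (Fin n) (Fin n) ℂ) : X A 0 = 1 := by
  have : (n.factorial : ℂ) ≠ 0 := by exact_mod_cast n.factorial_ne_zero
  simp [X, G, Matrix.permanent, Fintype.card_perm, this]

lemma X_eq_zero_of_G_eq_zero {A : Matrix (Fin n) (Fin n) ℂ} {z : ℂ} (h : G A z = 0) :
    X A z = 0 := by
  rw [X, h, mul_zero]

lemma IsSubexponentialIIDMatrix.measurable_X (hW : IsSubexponentialIIDMatrix P W ν K) (z : ℂ) :
    Measurable fun ω => X (W ω) z := by
  have hm := hW.measurable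
  unfold X G Matrix.permanent
  simp only [Matrix.add_apply, Matrix.of_apply, Matrix.smul_apply, smul_eq_mul]
  fun_prop

/-- The probability of a zero in a disk of radius `r`, in terms of a larger radius `R`. -/
lemma IsSubexponentialIIDMatrix.measureReal_exists_zero_le [IsProbabilityMeasure P]
    (hW : IsSubexponentialIIDMatrix P W ν K) (hK : 0 < K) (hν : 0 < ν) (hn : 1 ≤ n) {r : ℝ}
    (hr : 0 < r) (hrR : r < R) (h : ν * R ^ 2 / n ≤ 1 / (2048 * K ^ 2)) :
    P.real {ω | ∃ z : ℂ, ‖z‖ < r ∧ G (W ω) z = 0} ≤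
      6400000 * K ^ 4 * ν ^ 2 * R ^ 4 / n / (2 * Real.log (R / r)) := by
  have hR : 0 < R := hr.trans hrR
  have hE := hW.hasIIDEntries hK hν hn
  have hs := sq_scale_le hK hν hn h
  have hlog : 0 < Real.log (R / r) := Real.log_pos ((one_lt_div hr).2 hrR)
  have hn' : (1 : ℝ) ≤ n := by exact_mod_cast hn
  have hs' : 8 * (4 * K * √ν * R) ≤ n := by nlinarith [sq_nonneg (16 * (4 * K * √ν * R) - 1)]
  calc P.real {ω | ∃ z : ℂ, ‖z‖ < r ∧ G (W ω) z = 0}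
      ≤ P.real {ω | ∃ z : ℂ, ‖z‖ < r ∧ X (W ω) z = 0} := by
        refine measureReal_mono ?_ (measure_ne_top _ _)
        rintro ω ⟨z, hz, hG⟩
        exact ⟨z, hz, X_eq_zero_of_G_eq_zero hG⟩
    _ ≤ _ := PermanentUniversality.measureReal_exists_zero_le (f := fun ω => X (W ω)) hr hrR
        (fun ω => differentiable_X _) hW.measurable_X (fun ω => X_zero _)
        (fun z hz => (hE.integral_normSq_X_eq hR hs' (mem_sphere_zero_iff_norm.1 hz)).1)
        (fun z hz => hE.integral_normSq_X_pos hR hn hs (mem_sphere_zero_iff_norm.1 hz))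
        (hE.continuousOn_integral_normSq_X hR hn hs)
    _ ≤ _ := by
        rw [← pow_four_scale hν]
        gcongr
        exact hE.circleAverage_log_le hR hn hs

end Assembly

end PermanentUniversality

/-! ### Choice of radii and constants -/

theorem mainTheorem5 (K : ℝ) (hK : 0 < K) :
    -- the averaged second-moment bound, with constants depending only on `K`
    (∃ c > (0 : ℝ), ∃ C > (0 : ℝ),
      ∀ (n : ℕ), 1 ≤ n → ∀ (ν : ℝ), 0 < ν →
      ∀ (Ω : Type*) [MeasurableSpace Ω] (P : Measure Ω) [IsProbabilityMeasure P]
        (W : Ω → Matrix (Fin n) (Fin n) ℂ),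
        PermanentUniversality.IsSubexponentialIIDMatrix P W ν K →
      ∀ (R : ℝ), 0 < R → ν * R ^ 2 / (n : ℝ) ≤ c →
        (∀ z : ℂ, ‖z‖ = R → Integrable (fun ω => ‖PermanentUniversality.X (W ω) z‖ ^ 2) P) ∧
        CircleIntegrable
          (fun z => Real.log (∫ ω, ‖PermanentUniversality.X (W ω) z‖ ^ 2 ∂P)) 0 R ∧
        Real.circleAverage
          (fun z => Real.log (∫ ω, ‖PermanentUniversality.X (W ω) z‖ ^ 2 ∂P)) 0 R ≤
            C * ν ^ 2 * R ^ 4 / (n : ℝ)) ∧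
    -- the zero-free disk, with constants depending only on `K` and `ε`
    (∀ (ε : ℝ), 0 < ε → ε < 1 →
      ∃ C > (0 : ℝ), ∃ n₀ : ℕ,
      ∀ (β : ℝ), 0 < β → β < 1 / 4 →
      ∀ (n : ℕ), n₀ ≤ n → ∀ (ν : ℝ), 0 < ν →
      ∀ (Ω : Type*) [MeasurableSpace Ω] (P : Measure Ω) [IsProbabilityMeasure P]
        (W : Ω → Matrix (Fin n) (Fin n) ℂ),
        PermanentUniversality.IsSubexponentialIIDMatrix P W ν K →
        P.real {ω | ∃ z : ℂ, ‖z‖ < (1 - ε) * ((n : ℝ) ^ (1 / 4 - β) / √ν) ∧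
            PermanentUniversality.G (W ω) z = 0} ≤
          C * (n : ℝ) ^ (-(4 * β))) := by
  refine ⟨⟨1 / (2048 * K ^ 2), by positivity, 6400000 * K ^ 4, by positivity, ?_⟩, ?_⟩
  · intro n hn ν hν Ω _ P _ W hW R hR hc
    have hE := hW.hasIIDEntries hK hν hn
    have hs := PermanentUniversality.sq_scale_le hK hν hn hc
    have hn' : (1 : ℝ) ≤ n := by exact_mod_cast hn
    have hs' : 8 * (4 * K * √ν * R) ≤ n := by nlinarith [sq_nonneg (16 * (4 * K * √ν * R) - 1)]
    refine ⟨fun z hz => (hE.integral_normSq_X_eq hR hs' hz).1, hE.circleIntegrable_log hR hn hs, ?_⟩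
    rw [← PermanentUniversality.pow_four_scale hν]
    exact hE.circleAverage_log_le hR hn hs
  · intro ε hε0 hε1
    have hlog : 0 < Real.log (1 / (1 - ε)) :=
      Real.log_pos ((one_lt_div (by linarith)).2 (by linarith))
    -- The radii are `R = n^(1/4-β)/√ν` and `(1-ε)R`, whose ratio depends on `ε` alone. The
    -- threshold ensures `2048 K² ≤ √n`, which suffices for every `β > 0` because `νR² ≤ √n`.
    refine ⟨6400000 * K ^ 4 / (2 * Real.log (1 / (1 - ε))), by positivity,
      max 1 ⌈(2048 * K ^ 2) ^ 2⌉₊, ?_⟩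
    intro β hβ0 hβ1 n hn ν hν Ω _ P _ W hW
    have hn1 : 1 ≤ n := (le_max_left _ _).trans hn
    have hn0 : (0 : ℝ) < n := by exact_mod_cast hn1
    have hn1' : (1 : ℝ) ≤ n := by exact_mod_cast hn1
    have hnK : (2048 * K ^ 2) ^ 2 ≤ (n : ℝ) :=
      (Nat.le_ceil _).trans (by exact_mod_cast (le_max_right _ _).trans hn)
    have hsν : 0 < √ν := Real.sqrt_pos.2 hν
    set R := (n : ℝ) ^ (1 / 4 - β) / √ν with hRdef
    have hR : 0 < R := by positivity
    have hp : ν * R ^ 2 = (n : ℝ) ^ (1 / 2 - 2 * β) := by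
      rw [hRdef, div_pow, Real.sq_sqrt hν.le, mul_div_cancel₀ _ hν.ne', ← Real.rpow_mul_natCast hn0.le]
      congr 1
      push_cast
      ring
    have hp4 : ν ^ 2 * R ^ 4 / n = (n : ℝ) ^ (-(4 * β)) := by
      rw [show ν ^ 2 * R ^ 4 = (ν * R ^ 2) ^ 2 by ring, hp, ← Real.rpow_mul_natCast hn0.le,
        ← Real.rpow_sub_one hn0.ne']
      congr 1
      push_cast
      ring
    have hc : ν * R ^ 2 / n ≤ 1 / (2048 * K ^ 2) := by
      have hle : ν * R ^ 2 ≤ √n := by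
        rw [hp, Real.sqrt_eq_rpow]
        exact Real.rpow_le_rpow_of_exponent_le hn1' (by linarith)
      have hK' : 2048 * K ^ 2 ≤ √n := Real.le_sqrt_of_sq_le hnK
      rw [div_le_div_iff₀ hn0 (by positivity), one_mul]
      calc ν * R ^ 2 * (2048 * K ^ 2) ≤ √n * √n := by gcongr
        _ = n := Real.mul_self_sqrt hn0.le
    have h := hW.measureReal_exists_zero_le hK hν hn1 (r := (1 - ε) * R) (R := R)
      (mul_pos (by linarith) hR) (by nlinarith) hc
    refine h.trans (le_of_eq ?_)
    have e : R / ((1 - ε) * R) = 1 / (1 - ε) := by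
      have : 1 - ε ≠ 0 := by linarith
      field_simp
    rw [e, ← hp4]
    ring
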